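/- Let $V\subset\mathbb R^3$ be a bounded open set with $C^1$ boundary (lying locally on one side of it), let $m,e\in\mathbb R$ be the mass and charge of a point particle, and for $r\in V$ put $$\phi_{\rm sing}^{r}(x)=\frac{e}{4\pi|x-r|},\qquad D_{\rm sing}^{r}(x)=\frac{e\,(x-r)}{4\pi|x-r|^3}.$$ A monopole field in $V$ with the particle at $r$ is given by a function $\phi_{\rm reg}\in C^2(V)\cap C^1(\overline V)$ such that, with $D_{\rm reg}=-\nabla\phi_{\rm reg}$, the total field $D=D_{\rm sing}^r+D_{\rm reg}$ satisfies the Gauss law $\nabla\cdot D=e\,\delta_{r}$ in $V$ in the sense of distributions; its total potential is $\phi=\phi^r_{\rm sing}+\phi_{\rm reg}$. Its renormalized energy is $$\mathcal H_V=m-\frac12\int_{\mathbb R^3\setminus V}|D_{\rm sing}^{r}|^2\,dv+\frac12\int_V|D_{\rm reg}|^2\,dv+\int_V D_{\rm sing}^{r}\cdot D_{\rm reg}\,dv ,$$ and its free energy is $\mathcal F_V=\mathcal H_V-e\,\phi_{\rm reg}(r)$. Let $U\subseteq V$ be an open set of particle positions, let a monopole field in $V$ with the particle at $r$ be given for every $r\in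 U$, and let $f$ be a function on $\partial V$ that does not depend on $r$. Then the integrals in $\mathcal H_V$ converge absolutely for every $r\in U$, and the following holds for every $r_0\in U$, where $D_{\rm reg}(r_0)$ is the regular part of the field belonging to the position $r_0$, evaluated at $r_0$. 1. (Neumann data fixed.) If $D\cdot n=f$ on $\partial V$ for every $r\in U$, where $n$ is the outward unit normal, then $\mathcal H_V$ is (Fréchet) differentiable at $r_0$ as a function of the particle's position, and $$\delta\mathcal H_V=-e\,D_{\rm reg}(r_0)\cdot\delta r_0 .$$ 2. (Dirichlet data fixed.) If $\phi=f$ on $\partial V$ for every $r\in U$, then $\mathcal F_V$ is differentiable at $r_0$ as a function of the particle's position, and $$\delta\bigl(\mathcal H_V-e\,\phi_{\rm reg}(r_0)\bigr)=e\,D_{\rm reg}(r_0)\cdot\delta r_0 .$$ Consequently, if $e\neq0$, the equilibrium condition ($\delta\mathcal H_V=0$ in case 1, $\delta\mathcal F_V=0$ in case 2) holds at $r_0$ if and only if $D_{\rm reg}(r_0)=0$; in particular $D_{\rm reg}(r_0)=0$ whenever $r_0$ is a local extremum of $\mathcal H_V$ (case 1) or $\mathcal F_V$ (case 2). -/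

import Mathlib

noncomputable section

namespace Monopole

/-- Physical space `ℝ³` with its Euclidean structure. -/
abbrev Space : Type := EuclideanSpace ℝ (Fin 3)

/-- `ρ` is a `C¹` function on the open set `W`, without critical points, and `V` is the set
`{ρ < 0}` inside `W`. -/
def IsLocalDefiningFunction (V W : Set Space) (ρ : Space → ℝ) : Prop :=
  IsOpen W ∧ ContDiffOn ℝ 1 ρ W ∧ (∀ y ∈ W, gradient ρ y ≠ 0) ∧
    V ∩ W = {y | y ∈ W ∧ ρ y < 0}

/-- The boundary of `V` is a `C¹` surface, with `V` locally on one side of it. -/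
def HasC1Boundary (V : Set Space) : Prop :=
  ∀ x ∈ frontier V, ∃ (W : Set Space) (ρ : Space → ℝ), x ∈ W ∧ IsLocalDefiningFunction V W ρ

/-- `n` is the outward unit normal to `∂V` at the boundary point `x`. -/
def IsOutwardUnitNormal (V : Set Space) (x n : Space) : Prop :=
  x ∈ frontier V ∧ ∃ (W : Set Space) (ρ : Space → ℝ), x ∈ W ∧ IsLocalDefiningFunction V W ρ ∧
    n = ‖gradient ρ x‖⁻¹ • gradient ρ x

/-- The Coulomb potential of a charge `e` at the point `r`. -/
def singPotential (e : ℝ) (r x : Space) : ℝ :=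
  e / (4 * Real.pi * ‖x - r‖)

/-- The Coulomb field of a charge `e` at the point `r`. -/
def singField (e : ℝ) (r x : Space) : Space :=
  (e / (4 * Real.pi * ‖x - r‖ ^ 3)) • (x - r)

/-- `φreg` and `Dreg` are the regular parts of the potential and of the field of an electrostatic
configuration in `V` with a point charge `e` at `r`: the regular part of the potential is `C²`
in `V`, it and its gradient extend continuously to the closure of `V`, `Dreg = -∇φreg`, and the
total field `D = singField e r + Dreg` satisfies the Gauss law `div D = e δ_r` in `V` in the sense
of distributions. -/
structure IsMonopoleField (V : Set Space) (e : ℝ) (r : Space)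
    (φreg : Space → ℝ) (Dreg : Space → Space) : Prop where
  contDiffOn_potential : ContDiffOn ℝ 2 φreg V
  continuousOn_potential : ContinuousOn φreg (closure V)
  continuousOn_field : ContinuousOn Dreg (closure V)
  field_eq : ∀ x ∈ V, Dreg x = -gradient φreg x
  gauss : ∀ ψ : Space → ℝ, ContDiff ℝ (⊤ : ℕ∞) ψ → HasCompactSupport ψ → tsupport ψ ⊆ V →
    -∫ x in V, inner ℝ (singField e r x + Dreg x) (gradient ψ x) = e * ψ r

/-- The Neumann condition `D^⊥ = f` on `∂V` for the total field. -/
def NeumannCondition (V : Set Space) (e : ℝ) (r : Space) (Dreg : Space → Space)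
    (f : Space → ℝ) : Prop :=
  ∀ x n : Space, IsOutwardUnitNormal V x n → inner ℝ (singField e r x + Dreg x) n = f x

/-- The Dirichlet condition `φ = f` on `∂V` for the total potential. -/
def DirichletCondition (V : Set Space) (e : ℝ) (r : Space) (φreg : Space → ℝ)
    (f : Space → ℝ) : Prop :=
  ∀ x ∈ frontier V, singPotential e r x + φreg x = f x

/-- The three integrals in the renormalized energy converge absolutely. -/
def EnergyConverges (V : Set Space) (e : ℝ) (r : Space) (Dreg : Space → Space) : Prop :=
  MeasureTheory.IntegrableOn (fun x => ‖singField e r x‖ ^ 2) Vᶜ ∧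
  MeasureTheory.IntegrableOn (fun x => ‖Dreg x‖ ^ 2) V ∧
  MeasureTheory.IntegrableOn (fun x => inner ℝ (singField e r x) (Dreg x)) V

/-- The renormalized energy `H_V` of the particle and the field contained in `V`, for a particle
of mass `m` and charge `e` at `r`, the regular part of the field being `Dreg`. -/
def energy (V : Set Space) (m e : ℝ) (r : Space) (Dreg : Space → Space) : ℝ :=
  m - (1 / 2) * (∫ x in Vᶜ, ‖singField e r x‖ ^ 2) + (1 / 2) * (∫ x in V, ‖Dreg x‖ ^ 2)
    + ∫ x in V, inner ℝ (singField e r x) (Dreg x)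

/-- The free energy `F_V = H_V - e φreg(r)`. -/
def freeEnergy (V : Set Space) (m e : ℝ) (r : Space) (φreg : Space → ℝ)
    (Dreg : Space → Space) : ℝ :=
  energy V m e r Dreg - e * φreg r

end Monopole

end

noncomputable section

open Set Filter Topology MeasureTheory Metric

namespace Monopole

/-! The variation is controlled by an exact identity between two particle positions, so no
regularity of the field in the parameter `r` is needed. Let `u`, `D` and `v`, `E` be the regular
parts for the positions `r` and `s`. Under fixed Neumann data the energies differ by `e (v r - v s)`
plus half of `energyGap`, the squared L² norm of the difference of the regular fields in `V` plus
that of the singular fields outside. Under fixed Dirichlet data the free energies satisfy the same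
identity with `-e` in place of `e` (`energy_sub_energy_of_neumann`,
`freeEnergy_sub_freeEnergy_of_dirichlet`).

Exchanging `r` and `s` and adding the two identities expresses the gap as `σ` times an increment of
the harmonic function `u - v`, with `σ = ±e`. An interior estimate (`exists_harmonic_sub_le`) bounds
this increment by a constant times `∫ ‖D - E‖` times the displacement, and this integral is
controlled by the square root of the gap. Hence the gap is of second order in the displacement. Only
the increment of the fixed potential `v` remains at first order, and its gradient is `-E`
(`hasGradientAt_of_energyGap`).

The identities are Green formulas in a domain with only a `C¹` boundary. Since each needed boundary
term vanishes, surface integrals are avoided: `integral_eq_of_tangential` is a divergence theorem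
for tangential fields, proved with cutoffs in thin boundary layers. Coulomb singularities are
handled by the fundamental solution identity (`integral_fderiv_singField`) and by potentials cut off
near the charges (`farPotential`). -/

/-! ### Coulomb potentials, their regularization and their integrability. -/

/-- The potential of a charge `e` at `r`, smoothed at the scale `√ε`. -/
def smoothedPotential (e ε : ℝ) (r x : Space) : ℝ :=
  e / (4 * Real.pi * √(‖x - r‖ ^ 2 + ε))

/-- The field of the smoothed potential. -/
def smoothedField (e ε : ℝ) (r x : Space) : Space :=
  (e / (4 * Real.pi * √(‖x - r‖ ^ 2 + ε) ^ 3)) • (x - r)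

lemma smoothedPotential_zero (e : ℝ) (r : Space) :
    smoothedPotential e 0 r = singPotential e r := by
  funext x
  simp [smoothedPotential, singPotential]

lemma smoothedField_zero (e : ℝ) (r : Space) : smoothedField e 0 r = singField e r := by
  funext x
  simp [smoothedField, singField]

lemma contDiffAt_smoothedPotential (e : ℝ) {ε : ℝ} {r x : Space} (h : 0 < ‖x - r‖ ^ 2 + ε)
    {n : WithTop ℕ∞} : ContDiffAt ℝ n (smoothedPotential e ε r) x := by
  unfold smoothedPotential
  have h1 : ContDiffAt ℝ n (fun y : Space => ‖y - r‖ ^ 2 + ε) x :=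
    ((contDiff_id.sub contDiff_const).norm_sq ℝ).contDiffAt.add contDiffAt_const
  refine contDiffAt_const.div (contDiffAt_const.mul (h1.sqrt h.ne')) ?_
  have := Real.sqrt_pos.2 h
  positivity

lemma fderiv_smoothedPotential (e : ℝ) {ε : ℝ} {r x : Space} (h : 0 < ‖x - r‖ ^ 2 + ε)
    (v : Space) :
    fderiv ℝ (smoothedPotential e ε r) x v = -inner ℝ (smoothedField e ε r x) v := by
  have h0 : HasFDerivAt (fun y : Space => y - r) (ContinuousLinearMap.id ℝ Space) x :=
    (hasFDerivAt_id x).sub_const r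
  have h1 := (h0.norm_sq.add_const ε).sqrt h.ne'
  have hs := Real.sqrt_pos.2 h
  have h2 := (hasDerivAt_inv (by positivity : 4 * Real.pi * √(‖x - r‖ ^ 2 + ε) ≠ 0)).comp_hasFDerivAt
    x (h1.const_mul (4 * Real.pi))
  have h3 := h2.const_mul e
  have h4 : HasFDerivAt (smoothedPotential e ε r) _ x := h3
  rw [h4.fderiv]
  simp only [smoothedField, inner_smul_left]
  simp only [smul_eq_mul, conj_trivial, _root_.smul_apply, one_div, neg_smul,
    _root_.neg_apply, ContinuousLinearMap.comp_apply, ContinuousLinearMap.id_apply,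
    innerSL_apply_apply, nsmul_eq_mul, Nat.cast_ofNat]
  field_simp

lemma contDiffAt_singPotential (e : ℝ) {r x : Space} (h : x ≠ r) {n : WithTop ℕ∞} :
    ContDiffAt ℝ n (singPotential e r) x := by
  rw [← smoothedPotential_zero]
  have := norm_pos_iff.2 (sub_ne_zero.2 h)
  exact contDiffAt_smoothedPotential e (by positivity)

lemma fderiv_singPotential (e : ℝ) {r x : Space} (h : x ≠ r) (v : Space) :
    fderiv ℝ (singPotential e r) x v = -inner ℝ (singField e r x) v := by
  rw [← smoothedPotential_zero, ← smoothedField_zero]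
  have := norm_pos_iff.2 (sub_ne_zero.2 h)
  exact fderiv_smoothedPotential e (by positivity) v

lemma contDiffAt_singField (e : ℝ) {r x : Space} (h : x ≠ r) {n : WithTop ℕ∞} :
    ContDiffAt ℝ n (singField e r) x := by
  have h1 := norm_pos_iff.2 (sub_ne_zero.2 h)
  have h2 : ContDiffAt ℝ n (fun y : Space => y - r) x := contDiffAt_id.sub contDiffAt_const
  exact (contDiffAt_const.div (contDiffAt_const.mul ((h2.norm ℝ (sub_ne_zero.2 h)).pow 3))
    (by positivity)).smul h2

lemma continuousAt_singField (e : ℝ) {r x : Space} (h : x ≠ r) :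
    ContinuousAt (singField e r) x :=
  (contDiffAt_singField e h (n := 0)).continuousAt

lemma norm_singField (e : ℝ) (r x : Space) :
    ‖singField e r x‖ = |e| / (4 * Real.pi) * (‖x - r‖ ^ 2)⁻¹ := by
  rw [singField, norm_smul, Real.norm_eq_abs, abs_div, abs_of_nonneg (by positivity :
    0 ≤ 4 * Real.pi * ‖x - r‖ ^ 3)]
  rcases eq_or_ne (‖x - r‖) 0 with h | h
  · simp [h]
  · field_simp

lemma abs_singPotential (e : ℝ) (r x : Space) :
    |singPotential e r x| = |e| / (4 * Real.pi) * ‖x - r‖⁻¹ := by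
  rw [singPotential, abs_div, abs_of_nonneg (by positivity : 0 ≤ 4 * Real.pi * ‖x - r‖)]
  rw [div_mul_eq_div_div, div_eq_mul_inv]

lemma measurable_singField (e : ℝ) (r : Space) : Measurable (singField e r) := by
  unfold singField
  fun_prop

lemma measurable_singPotential (e : ℝ) (r : Space) : Measurable (singPotential e r) := by
  unfold singPotential
  fun_prop

lemma measurable_smoothedField (e ε : ℝ) (r : Space) : Measurable (smoothedField e ε r) := by
  unfold smoothedField
  fun_prop

lemma measurable_smoothedPotential (e ε : ℝ) (r : Space) :
    Measurable (smoothedPotential e ε r) := by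
  unfold smoothedPotential
  fun_prop

lemma norm_smoothedField_le (e : ℝ) {ε : ℝ} (hε : 0 ≤ ε) {r x : Space} (h : x ≠ r) :
    ‖smoothedField e ε r x‖ ≤ ‖singField e r x‖ := by
  have h1 := norm_pos_iff.2 (sub_ne_zero.2 h)
  have h2 : ‖x - r‖ ≤ √(‖x - r‖ ^ 2 + ε) := Real.le_sqrt_of_sq_le (by linarith)
  simp only [smoothedField, singField, norm_smul, Real.norm_eq_abs, abs_div]
  rw [abs_of_nonneg (by positivity : 0 ≤ 4 * Real.pi * ‖x - r‖ ^ 3),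
    abs_of_nonneg (by positivity : 0 ≤ 4 * Real.pi * √(‖x - r‖ ^ 2 + ε) ^ 3)]
  gcongr

lemma abs_smoothedPotential_le (e : ℝ) {ε : ℝ} (hε : 0 ≤ ε) {r x : Space} (h : x ≠ r) :
    |smoothedPotential e ε r x| ≤ |singPotential e r x| := by
  have h1 := norm_pos_iff.2 (sub_ne_zero.2 h)
  have h2 : ‖x - r‖ ≤ √(‖x - r‖ ^ 2 + ε) := Real.le_sqrt_of_sq_le (by linarith)
  simp only [smoothedPotential, singPotential, abs_div]
  rw [abs_of_nonneg (by positivity : 0 ≤ 4 * Real.pi * ‖x - r‖),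
    abs_of_nonneg (by positivity : 0 ≤ 4 * Real.pi * √(‖x - r‖ ^ 2 + ε))]
  gcongr

lemma tendsto_smoothedField (e : ℝ) {r x : Space} (h : x ≠ r) :
    Tendsto (fun ε => smoothedField e ε r x) (𝓝 0) (𝓝 (singField e r x)) := by
  have h1 := norm_pos_iff.2 (sub_ne_zero.2 h)
  rw [← smoothedField_zero]
  have : ContinuousAt (fun ε => smoothedField e ε r x) 0 := by
    unfold smoothedField
    refine ContinuousAt.smul (ContinuousAt.div (f := fun _ => e) (by fun_prop) ?_ ?_) continuousAt_const
    · fun_prop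
    have : 0 < √(‖x - r‖ ^ 2 + 0) := Real.sqrt_pos.2 (by positivity)
    positivity
  exact this

lemma tendsto_smoothedPotential (e : ℝ) {r x : Space} (h : x ≠ r) :
    Tendsto (fun ε => smoothedPotential e ε r x) (𝓝 0) (𝓝 (singPotential e r x)) := by
  have h1 := norm_pos_iff.2 (sub_ne_zero.2 h)
  rw [← smoothedPotential_zero]
  have : ContinuousAt (fun ε => smoothedPotential e ε r x) 0 := by
    unfold smoothedPotential
    refine ContinuousAt.div (f := fun _ => e) (by fun_prop) ?_ ?_
    · fun_prop
    have : 0 < √(‖x - r‖ ^ 2 + 0) := Real.sqrt_pos.2 (by positivity)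
    positivity
  exact this

lemma integrable_fun_norm_sub {f : ℝ → ℝ} (r : Space)
    (hf : IntegrableOn (fun t : ℝ => t ^ 2 * f t) (Ioi 0)) :
    Integrable (fun x : Space => f ‖x - r‖) := by
  have h := (integrable_fun_norm_addHaar (E := Space) volume (f := f)).2 (by simpa using hf)
  exact h.comp_sub_right r

/-- In polar coordinates the volume factor `t ^ 2` absorbs the singularity, leaving the bounded
integrand `t ^ (2 - k)`. -/
lemma integrableOn_ball_norm_inv_pow {k : ℕ} (hk : k ≤ 2) (r : Space) (R : ℝ) :
    IntegrableOn (fun x : Space => (‖x - r‖ ^ k)⁻¹) (ball r R) := by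
  rw [← integrable_indicator_iff measurableSet_ball]
  refine (integrable_fun_norm_sub (f := (Iio R).indicator fun t : ℝ => (t ^ k)⁻¹) r ?_).congr
    (ae_of_all _ fun x => by simp [indicator, dist_eq_norm])
  · have : IntegrableOn (fun t : ℝ => (Iio R).indicator (fun t => t ^ (2 - k)) t) (Ioi 0) := by
      rw [IntegrableOn, integrable_indicator_iff measurableSet_Iio, IntegrableOn,
        Measure.restrict_restrict measurableSet_Iio, inter_comm, Ioi_inter_Iio]
      exact ((continuous_pow _).integrableOn_Icc).mono_set Ioo_subset_Icc_self
    refine this.congr_fun (fun t ht => ?_) measurableSet_Ioi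
    have ht : t ≠ 0 := ne_of_gt ht
    by_cases h : t < R
    · simp only [indicator, mem_Iio, h, if_true]
      rw [pow_sub₀ t ht hk]
    · simp [indicator, h]

/-- The radial integrand is `t ^ 2 * t ^ (-4) = t ^ (-2)`, integrable at infinity. This makes the
exterior Coulomb energy finite. -/
lemma integrableOn_compl_ball_norm_inv_pow (r : Space) {s : ℝ} (hs : 0 < s) :
    IntegrableOn (fun x : Space => (‖x - r‖ ^ 4)⁻¹) (ball r s)ᶜ := by
  rw [← integrable_indicator_iff measurableSet_ball.compl]
  refine (integrable_fun_norm_sub (f := (Ici s).indicator fun t : ℝ => (t ^ 4)⁻¹) r ?_).congr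
    (ae_of_all _ fun x => by simp [indicator, dist_eq_norm])
  · have : IntegrableOn (fun t : ℝ => (Ici s).indicator (fun t => t ^ (-2 : ℝ)) t) (Ioi 0) := by
      rw [IntegrableOn, integrable_indicator_iff measurableSet_Ici, IntegrableOn,
        Measure.restrict_restrict measurableSet_Ici]
      refine ((integrableOn_Ioi_rpow_of_lt (a := -2) (by norm_num) (half_pos hs)).mono_set ?_)
      intro t ht
      have : s ≤ t := ht.1
      simp only [mem_Ioi]
      linarith
    refine this.congr_fun (fun t ht => ?_) measurableSet_Ioi
    have ht : 0 < t := ht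
    by_cases h : s ≤ t
    · simp only [indicator, mem_Ici, h, if_true]
      rw [Real.rpow_neg ht.le, Real.rpow_two]
      field_simp
    · simp [indicator, h]

lemma locallyIntegrable_norm_inv_pow {k : ℕ} (hk : k ≤ 2) (r : Space) :
    LocallyIntegrable (fun x : Space => (‖x - r‖ ^ k)⁻¹) := by
  intro x
  exact ⟨ball r (dist x r + 1), isOpen_ball.mem_nhds (by simp),
    integrableOn_ball_norm_inv_pow hk r _⟩

lemma locallyIntegrable_singField (e : ℝ) (r : Space) : LocallyIntegrable (singField e r) := by
  refine ((locallyIntegrable_norm_inv_pow le_rfl r).smul (|e| / (4 * Real.pi))).mono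
    (measurable_singField e r).aestronglyMeasurable (ae_of_all _ fun x => ?_)
  rw [norm_singField]
  exact le_abs_self _

lemma locallyIntegrable_singPotential (e : ℝ) (r : Space) :
    LocallyIntegrable (singPotential e r) := by
  refine ((locallyIntegrable_norm_inv_pow one_le_two r).smul (|e| / (4 * Real.pi))).mono
    (measurable_singPotential e r).aestronglyMeasurable (ae_of_all _ fun x => ?_)
  rw [Real.norm_eq_abs, abs_singPotential, ← pow_one ‖x - r‖]
  exact le_abs_self _

lemma integrableOn_sq_norm_singField (e : ℝ) {r : Space} {A : Set Space} (hA : Aᶜ ∈ 𝓝 r) :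
    IntegrableOn (fun x => ‖singField e r x‖ ^ 2) A := by
  obtain ⟨s, hs, hsA⟩ := Metric.mem_nhds_iff.1 hA
  have h := ((integrableOn_compl_ball_norm_inv_pow r hs).mono_set (subset_compl_comm.1 hsA)).const_mul
    ((|e| / (4 * Real.pi)) ^ 2)
  refine h.congr (ae_of_all _ fun x => ?_)
  simp only [norm_singField, mul_pow, inv_pow]
  congr 2
  ring

/-! ### Polar coordinates and the fundamental solution. -/

lemma toSphere_real_univ :
    (volume : Measure Space).toSphere.real univ = 4 * Real.pi := by
  rw [Measure.toSphere_real_apply_univ, measureReal_def, EuclideanSpace.volume_ball_fin_three]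
  simp only [finrank_euclideanSpace, Fintype.card_fin]
  rw [ENNReal.toReal_mul, ENNReal.toReal_ofReal (by positivity)]
  simp
  ring

/-- Integration in polar coordinates, given on each ray the value of the radial integral. -/
lemma integral_eq_of_radial {F : Space → ℝ} (hF : Integrable F) {c : ℝ}
    (h : ∀ ω : Space, ‖ω‖ = 1 → IntegrableOn (fun t : ℝ => t ^ 2 * F (t • ω)) (Ioi 0) →
      ∫ t in Ioi (0 : ℝ), t ^ 2 * F (t • ω) = c) :
    ∫ x, F x = 4 * Real.pi * c := by
  have hmp := (volume : Measure Space).measurePreserving_homeomorphUnitSphereProd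
  have hemb := (homeomorphUnitSphereProd Space).measurableEmbedding
  set g : sphere (0 : Space) 1 × Ioi (0 : ℝ) → ℝ := fun p => F (p.2.1 • p.1.1) with hg
  have hcomp : g ∘ homeomorphUnitSphereProd Space = fun x => F x.1 := by
    funext x
    have hx : ‖(x : Space)‖ ≠ 0 := norm_ne_zero_iff.2 x.2
    simp [hg, smul_smul, hx]
  have h1 : ∫ x, F x = ∫ p, g p ∂((volume : Measure Space).toSphere.prod
      (Measure.volumeIoiPow 2)) := by
    have h2 := hmp.integral_comp hemb g
    simp only [finrank_euclideanSpace, Fintype.card_fin] at h2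
    rw [← h2, ← setIntegral_univ, ← setIntegral_congr_set (ae_eq_univ.2 (by simp) :
        ({0}ᶜ : Set Space) =ᵐ[volume] univ),
      ← integral_subtype_comap (measurableSet_singleton _).compl F]
    exact integral_congr_ae (ae_of_all _ fun x => (congrFun hcomp x).symm)
  have h3 : Integrable g ((volume : Measure Space).toSphere.prod (Measure.volumeIoiPow 2)) := by
    have h2 := hmp.integrable_comp_emb hemb (g := g)
    simp only [finrank_euclideanSpace, Fintype.card_fin] at h2
    rw [← h2, hcomp]
    have := (integrableOn_iff_comap_subtypeVal (measurableSet_singleton (0 : Space)).compl).1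
      hF.integrableOn
    exact this
  rw [h1, integral_prod _ h3, ← toSphere_real_univ, ← smul_eq_mul, ← integral_const]
  -- By Fubini almost every ray carries an integrable function, which is why `h` may assume
  -- integrability on the ray.
  refine integral_congr_ae (h3.prod_right_ae.mono fun ω hω => ?_)
  have hω1 : ‖(ω : Space)‖ = 1 := by simp
  rw [← h ω hω1 ?_]
  · simp only [Measure.volumeIoiPow, ENNReal.ofReal]
    rw [integral_withDensity_eq_integral_smul (by fun_prop),
      integral_subtype_comap measurableSet_Ioi fun a ↦ Real.toNNReal (a ^ 2) • F (a • ω.1)]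
    refine setIntegral_congr_fun measurableSet_Ioi fun t ht => ?_
    rw [NNReal.smul_def, Real.coe_toNNReal _ (by positivity), smul_eq_mul]
  · simp only [Measure.volumeIoiPow, ENNReal.ofReal] at hω
    rw [integrable_withDensity_iff_integrable_smul (by fun_prop)] at hω
    have h4 := (integrableOn_iff_comap_subtypeVal measurableSet_Ioi (μ := volume)
      (f := fun a : ℝ ↦ Real.toNNReal (a ^ 2) • F (a • ω.1))).2 hω
    refine h4.congr_fun (fun t ht => ?_) measurableSet_Ioi
    simp only []
    rw [NNReal.smul_def, Real.coe_toNNReal _ (by positivity), smul_eq_mul]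

/-- The Coulomb field is the fundamental solution of the divergence equation. -/
lemma integral_fderiv_singField {e : ℝ} {r : Space} {ψ : Space → ℝ} (hψ : ContDiff ℝ 1 ψ)
    (h0 : Tendsto ψ (cocompact Space) (𝓝 0))
    (hi : Integrable fun x => fderiv ℝ ψ x (singField e r x)) :
    ∫ x, fderiv ℝ ψ x (singField e r x) = -(e * ψ r) := by
  rw [← integral_add_right_eq_self _ r]
  have hi' := hi.comp_add_right r
  rw [integral_eq_of_radial hi' (c := -(e / (4 * Real.pi) * ψ r))]
  · field_simp
  intro ω hω hint
  have hd : ∀ t : ℝ, HasDerivAt (fun t : ℝ => e / (4 * Real.pi) * ψ (t • ω + r))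
      (e / (4 * Real.pi) * fderiv ℝ ψ (t • ω + r) ω) t := by
    intro t
    refine HasDerivAt.const_mul _ ?_
    have h1 : HasDerivAt (fun t : ℝ => t • ω + r) ω t := by
      simpa using ((hasDerivAt_id t).smul_const ω).add_const r
    exact ((hψ.differentiable one_ne_zero _).hasFDerivAt).comp_hasDerivAt t h1
  -- The volume factor cancels the inverse-square law, so the integrand on a ray is an exact
  -- derivative and only the value of `ψ` at the charge survives.
  have hcongr : ∀ t ∈ Ioi (0 : ℝ), t ^ 2 * fderiv ℝ ψ (t • ω + r) (singField e r (t • ω + r)) =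
      e / (4 * Real.pi) * fderiv ℝ ψ (t • ω + r) ω := by
    intro t ht
    have ht : 0 < t := ht
    simp only [singField, add_sub_cancel_right, norm_smul, hω, Real.norm_eq_abs, abs_of_pos ht,
      map_smul, smul_eq_mul]
    field_simp
  rw [setIntegral_congr_fun measurableSet_Ioi hcongr]
  have hlim : Tendsto (fun t : ℝ => e / (4 * Real.pi) * ψ (t • ω + r)) atTop (𝓝 0) := by
    have h2 : Tendsto (fun t : ℝ => t • ω + r) atTop (cocompact Space) := by
      rw [← Metric.cobounded_eq_cocompact, ← tendsto_norm_atTop_iff_cobounded]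
      refine tendsto_atTop_mono' _ (f₁ := fun t : ℝ => t - ‖r‖) ?_
        (tendsto_atTop_add_const_right _ _ tendsto_id)
      filter_upwards [eventually_ge_atTop 0] with t ht
      have := norm_sub_norm_le (t • ω) (-r)
      rw [norm_smul, hω, Real.norm_eq_abs, abs_of_nonneg ht, norm_neg, sub_neg_eq_add] at this
      linarith
    simpa using (h0.comp h2).const_mul (e / (4 * Real.pi))
  rw [integral_Ioi_of_hasDerivAt_of_tendsto' (fun t _ => hd t)
    (hint.congr_fun hcongr measurableSet_Ioi) hlim]
  simp

lemma measurable_fderiv_apply {ψ : Space → ℝ} (hψ : Continuous (fderiv ℝ ψ)) {S : Space → Space}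
    (hS : Measurable S) : Measurable fun x => fderiv ℝ ψ x (S x) :=
  (continuous_fst.clm_apply continuous_snd).measurable.comp (hψ.measurable.prodMk hS)

lemma integral_fderiv_singField_of_hasCompactSupport (e : ℝ) (r : Space) {ψ : Space → ℝ}
    (hψ : ContDiff ℝ 1 ψ) (hc : HasCompactSupport ψ) :
    Integrable (fun x => fderiv ℝ ψ x (singField e r x)) ∧
    ∫ x, fderiv ℝ ψ x (singField e r x) = -(e * ψ r) := by
  have hcont := hψ.continuous_fderiv one_ne_zero
  have hi : Integrable (fun x => fderiv ℝ ψ x (singField e r x)) := by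
    obtain ⟨C, hC⟩ := hcont.norm.bddAbove_range_of_hasCompactSupport (hc.fderiv ℝ).norm
    have h1 : IntegrableOn (singField e r) (tsupport ψ) :=
      (locallyIntegrable_singField e r).integrableOn_isCompact hc
    have h2 : IntegrableOn (fun x => fderiv ℝ ψ x (singField e r x)) (tsupport ψ) := by
      refine (h1.norm.const_mul C).mono' ?_ (ae_of_all _ fun x => ?_)
      · exact (measurable_fderiv_apply hcont (measurable_singField e r)).aestronglyMeasurable
      · exact ((fderiv ℝ ψ x).le_opNorm _).trans
          (mul_le_mul_of_nonneg_right (hC ⟨x, rfl⟩) (norm_nonneg _))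
    refine (integrableOn_iff_integrable_of_support_subset fun x hx => ?_).1 h2
    by_contra h
    exact hx (by simp [fderiv_of_notMem_tsupport (𝕜 := ℝ) h])
  exact ⟨hi, integral_fderiv_singField hψ hc.is_zero_at_infty hi⟩

/-! ### Integration by parts and weakly harmonic fields. -/

/-- The standard basis vectors of `ℝ³`. -/
abbrev stdVec (i : Fin 3) : Space := EuclideanSpace.single i (1 : ℝ)

lemma apply_eq_sum_stdVec (L : Space →L[ℝ] ℝ) (y : Space) : L y = ∑ i, y i * L (stdVec i) := by
  conv_lhs => rw [← (EuclideanSpace.basisFun (Fin 3) ℝ).sum_repr y]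
  simp

/-- The divergence of a vector field. -/
def divergence (q : Space → Space) (x : Space) : ℝ :=
  ∑ i, fderiv ℝ (fun y => q y i) x (stdVec i)

lemma integral_fderiv_eq_zero {h : Space → ℝ} (hh : ContDiff ℝ 1 h) (hc : HasCompactSupport h)
    (v : Space) : ∫ x, fderiv ℝ h x v = 0 := by
  have h1 : Integrable fun x => fderiv ℝ h x v :=
    ((hh.continuous_fderiv one_ne_zero).clm_apply continuous_const).integrable_of_hasCompactSupport
      (hc.fderiv_apply ℝ v)
  have := integral_mul_fderiv_eq_neg_fderiv_mul_of_integrable (𝕜 := ℝ) (μ := (volume : Measure Space))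
    (f := fun _ => (1 : ℝ)) (g := h) (v := v) (by simp) (by simpa using h1)
    (by simpa using hh.continuous.integrable_of_hasCompactSupport hc)
    (fun _ _ => differentiableAt_const _) (fun x _ => hh.differentiable one_ne_zero x)
  simpa using this

lemma integrableOn_of_tsupport_subset {V : Set Space} {f g : Space → ℝ}
    (hc : HasCompactSupport f) (hf : tsupport f ⊆ V) (hg : ContinuousOn g V)
    (h0 : ∀ x ∉ tsupport f, g x = 0) : IntegrableOn g V ∧ Integrable g := by
  have h1 : Integrable g :=
    (integrableOn_iff_integrable_of_support_subset fun x hx => by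
      by_contra h; exact hx (h0 x h)).1 ((hg.mono hf).integrableOn_compact hc)
  exact ⟨h1.integrableOn, h1⟩

lemma contDiff_mul_of_tsupport_subset {V : Set Space} {f g : Space → ℝ} (hV : IsOpen V)
    (hf : ContDiff ℝ 1 f) (hfV : tsupport f ⊆ V) (hg : ContDiffOn ℝ 1 g V) :
    ContDiff ℝ 1 fun x => f x * g x := by
  rw [contDiff_iff_contDiffAt]
  intro x
  by_cases hx : x ∈ V
  · exact hf.contDiffAt.mul (hg.contDiffAt (hV.mem_nhds hx))
  · have : (fun x => f x * g x) =ᶠ[𝓝 x] fun _ => 0 := by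
      filter_upwards [(isClosed_tsupport f).isOpen_compl.mem_nhds fun h => hx (hfV h)] with y hy
      rw [image_eq_zero_of_notMem_tsupport hy, zero_mul]
    exact contDiffAt_const.congr_of_eventuallyEq this

lemma setIntegral_fderiv_mul {V : Set Space} {f g : Space → ℝ} (hV : IsOpen V)
    (hf : ContDiff ℝ 1 f) (hc : HasCompactSupport f) (hfV : tsupport f ⊆ V)
    (hg : ContDiffOn ℝ 1 g V) (v : Space) :
    IntegrableOn (fun x => fderiv ℝ f x v * g x) V ∧
    IntegrableOn (fun x => f x * fderiv ℝ g x v) V ∧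
    ∫ x in V, fderiv ℝ f x v * g x = -∫ x in V, f x * fderiv ℝ g x v := by
  have hf' := (hf.continuous_fderiv one_ne_zero).clm_apply (continuous_const (y := v))
  have hg' : ContinuousOn (fun x => fderiv ℝ g x v) V :=
    (hg.continuousOn_fderiv_of_isOpen hV le_rfl).clm_apply continuousOn_const
  have h1 := integrableOn_of_tsupport_subset (g := fun x => fderiv ℝ f x v * g x) hc hfV (hf'.continuousOn.mul hg.continuousOn)
    fun x hx => by simp [fderiv_of_notMem_tsupport (𝕜 := ℝ) hx]
  have h2 := integrableOn_of_tsupport_subset (g := fun x => f x * fderiv ℝ g x v) hc hfV (hf.continuous.continuousOn.mul hg')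
    fun x hx => by simp [image_eq_zero_of_notMem_tsupport hx]
  refine ⟨h1.1, h2.1, ?_⟩
  have h3 := integral_fderiv_eq_zero (contDiff_mul_of_tsupport_subset hV hf hfV hg)
    (hc.mul_right) v
  rw [eq_neg_iff_add_eq_zero, ← integral_add h1.1 h2.1, ← h3,
    ← setIntegral_eq_integral_of_forall_compl_eq_zero (s := V)
      (f := fun x => fderiv ℝ (fun x => f x * g x) x v)]
  · refine setIntegral_congr_fun hV.measurableSet fun x hx => ?_
    have hgx := (hg.differentiableOn one_ne_zero).differentiableAt (hV.mem_nhds hx)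
    rw [fderiv_fun_mul (hf.differentiable one_ne_zero x) hgx]
    simp
    ring
  · intro x hx
    have : (fun x => f x * g x) =ᶠ[𝓝 x] fun _ => 0 := by
      filter_upwards [(isClosed_tsupport f).isOpen_compl.mem_nhds fun h => hx (hfV h)] with y hy
      rw [image_eq_zero_of_notMem_tsupport hy, zero_mul]
    rw [this.fderiv_eq]
    simp

/-- Integration by parts against a compactly supported function. -/
lemma setIntegral_fderiv_apply_eq {V : Set Space} {ψ : Space → ℝ} {q : Space → Space}
    (hV : IsOpen V) (hψ : ContDiff ℝ 1 ψ) (hc : HasCompactSupport ψ) (hψV : tsupport ψ ⊆ V)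
    (hq : ContDiffOn ℝ 1 q V) :
    ∫ x in V, fderiv ℝ ψ x (q x) = -∫ x in V, ψ x * divergence q x := by
  have h := fun i => setIntegral_fderiv_mul hV hψ hc hψV (g := fun y => q y i)
    (contDiffOn_euclidean.1 hq i) (stdVec i)
  simp only [divergence, Finset.mul_sum, apply_eq_sum_stdVec _ (q _), mul_comm (q _ _)]
  rw [integral_finsetSum _ fun i _ => (h i).1, integral_finsetSum _ fun i _ => (h i).2.1,
    ← Finset.sum_neg_distrib]
  exact Finset.sum_congr rfl fun i _ => (h i).2.2

/-- Integration by parts against a compactly supported vector field. -/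
lemma setIntegral_mul_divergence {V : Set Space} {v : Space → ℝ} {q : Space → Space}
    (hV : IsOpen V) (hq : ContDiff ℝ 1 q) (hc : HasCompactSupport q) (hqV : tsupport q ⊆ V)
    (hv : ContDiffOn ℝ 1 v V) :
    ∫ x in V, v x * divergence q x = -∫ x in V, fderiv ℝ v x (q x) := by
  have hsub : ∀ i, tsupport (fun y => q y i) ⊆ tsupport q := fun i =>
    closure_mono fun x hx h => hx (by simp [h])
  have h := fun i => setIntegral_fderiv_mul hV (f := fun y => q y i) (contDiff_euclidean.1 hq i)
    (hc.of_isClosed_subset (isClosed_tsupport _) (hsub i)) ((hsub i).trans hqV) hv (stdVec i)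
  simp only [divergence, mul_comm (v _), Finset.sum_mul, apply_eq_sum_stdVec _ (q _)]
  rw [integral_finsetSum _ fun i _ => (h i).1, integral_finsetSum _ fun i _ => (h i).2.1,
    ← Finset.sum_neg_distrib]
  exact Finset.sum_congr rfl fun i _ => (h i).2.2

/-- `D` is the field of the potential `u`, both continuous up to the boundary of `V`, and `u` is
weakly harmonic in `V`. -/
structure IsHarmonicField (V : Set Space) (u : Space → ℝ) (D : Space → Space) : Prop where
  contDiffOn : ContDiffOn ℝ 1 u V
  continuousOn_potential : ContinuousOn u (closure V)
  continuousOn_field : ContinuousOn D (closure V)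
  fderiv_eq : ∀ x ∈ V, ∀ y, fderiv ℝ u x y = -inner ℝ (D x) y
  weak : ∀ ψ : Space → ℝ, ContDiff ℝ 1 ψ → HasCompactSupport ψ → tsupport ψ ⊆ V →
    ∫ x in V, fderiv ℝ ψ x (D x) = 0

lemma integrableOn_fderiv_apply {V : Set Space} {D : Space → Space}
    (hD : ContinuousOn D V) {ψ : Space → ℝ} (hψ : ContDiff ℝ 1 ψ) (hc : HasCompactSupport ψ)
    (hψV : tsupport ψ ⊆ V) : IntegrableOn (fun x => fderiv ℝ ψ x (D x)) V :=
  (integrableOn_of_tsupport_subset hc hψV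
    ((hψ.continuous_fderiv one_ne_zero).continuousOn.clm_apply hD)
    fun x hx => by simp [fderiv_of_notMem_tsupport (𝕜 := ℝ) hx]).1

lemma IsHarmonicField.sub {V : Set Space} (hV : IsOpen V) {u v : Space → ℝ} {D E : Space → Space}
    (hu : IsHarmonicField V u D) (hv : IsHarmonicField V v E) :
    IsHarmonicField V (fun x => u x - v x) (fun x => D x - E x) where
  contDiffOn := hu.contDiffOn.sub hv.contDiffOn
  continuousOn_potential := hu.continuousOn_potential.sub hv.continuousOn_potential
  continuousOn_field := hu.continuousOn_field.sub hv.continuousOn_field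
  fderiv_eq x hx y := by
    have h1 := (hu.contDiffOn.differentiableOn one_ne_zero).differentiableAt (hV.mem_nhds hx)
    have h2 := (hv.contDiffOn.differentiableOn one_ne_zero).differentiableAt (hV.mem_nhds hx)
    rw [fderiv_fun_sub h1 h2, _root_.sub_apply, hu.fderiv_eq x hx, hv.fderiv_eq x hx,
      inner_sub_left]
    ring
  weak ψ h1 h2 h3 := by
    simp only [map_sub]
    rw [integral_sub (integrableOn_fderiv_apply (hu.continuousOn_field.mono subset_closure)
      h1 h2 h3) (integrableOn_fderiv_apply (hv.continuousOn_field.mono subset_closure)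
      h1 h2 h3), hu.weak ψ h1 h2 h3, hv.weak ψ h1 h2 h3, sub_zero]

lemma setIntegral_fderiv_singField {V : Set Space} (e : ℝ) (r : Space) {ψ : Space → ℝ}
    (hψ : ContDiff ℝ 1 ψ) (hc : HasCompactSupport ψ) (hψV : tsupport ψ ⊆ V) :
    ∫ x in V, fderiv ℝ ψ x (singField e r x) = -(e * ψ r) := by
  rw [← (integral_fderiv_singField_of_hasCompactSupport e r hψ hc).2]
  refine setIntegral_eq_integral_of_forall_compl_eq_zero fun x hx => ?_
  simp [fderiv_of_notMem_tsupport (𝕜 := ℝ) fun h => hx (hψV h)]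

/-- The singular field already accounts for the point charge, so the Gauss law makes the regular
field weakly divergence free against smooth tests. As the potential is `C²`, its divergence is
continuous and vanishes almost everywhere in `V`; integrating by parts back extends the weak
equation to the `C¹` tests needed later. -/
lemma IsMonopoleField.isHarmonicField {V : Set Space} (hV : IsOpen V) {e : ℝ} {r : Space}
    {u : Space → ℝ} {D : Space → Space} (h : IsMonopoleField V e r u D) :
    IsHarmonicField V u D where
  contDiffOn := h.contDiffOn_potential.of_le one_le_two
  continuousOn_potential := h.continuousOn_potential
  continuousOn_field := h.continuousOn_field
  fderiv_eq x hx y := by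
    rw [h.field_eq x hx, inner_neg_left, neg_neg, inner_gradient_left]
  weak := by
    have hD : ContDiffOn ℝ 1 D V := by
      have h1 : ContDiffOn ℝ 1 (fun x => -gradient u x) V :=
        ((InnerProductSpace.toDual ℝ Space).symm.contDiff.comp_contDiffOn
          (h.contDiffOn_potential.fderiv_of_isOpen hV (by norm_num))).neg
      exact h1.congr h.field_eq
    have hsmooth : ∀ ψ : Space → ℝ, ContDiff ℝ (⊤ : ℕ∞) ψ → HasCompactSupport ψ →
        tsupport ψ ⊆ V → ∫ x in V, fderiv ℝ ψ x (D x) = 0 := by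
      intro ψ h1 h2 h3
      have h1' : ContDiff ℝ 1 ψ := h1.of_le (by exact_mod_cast le_top)
      have hg := h.gauss ψ h1 h2 h3
      simp only [inner_gradient_right, map_add, conj_trivial] at hg
      rw [integral_add (integral_fderiv_singField_of_hasCompactSupport e r h1' h2).1.integrableOn
        (integrableOn_fderiv_apply hD.continuousOn h1' h2 h3),
        setIntegral_fderiv_singField e r h1' h2 h3] at hg
      linarith
    have hdiv : ContinuousOn (divergence D) V := by
      refine continuousOn_finsetSum _ fun i _ => ?_
      exact ((contDiffOn_euclidean.1 hD i).continuousOn_fderiv_of_isOpen hV le_rfl).clm_apply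
        continuousOn_const
    have hae : ∀ᵐ x, x ∈ V → divergence D x = 0 := by
      refine hV.ae_eq_zero_of_integral_contDiff_smul_eq_zero
        (hdiv.locallyIntegrableOn hV.measurableSet) fun ψ h1 h2 h3 => ?_
      have h1' : ContDiff ℝ 1 ψ := h1.of_le (by exact_mod_cast le_top)
      have := setIntegral_fderiv_apply_eq hV h1' h2 h3 hD
      rw [hsmooth ψ h1 h2 h3] at this
      rw [← setIntegral_eq_integral_of_forall_compl_eq_zero (s := V)]
      · simpa using this.symm
      · intro x hx
        rw [image_eq_zero_of_notMem_tsupport fun h => hx (h3 h), zero_smul]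
    intro ψ h1 h2 h3
    rw [setIntegral_fderiv_apply_eq hV h1 h2 h3 hD, setIntegral_congr_ae (g := fun _ => 0)
      hV.measurableSet]
    · simp
    · filter_upwards [hae] with x hx hxV
      rw [hx hxV, mul_zero]

/-! ### Pairing harmonic fields with Coulomb fields. -/

lemma ae_ne_point (r : Space) (V : Set Space) : ∀ᵐ x ∂(volume.restrict V), x ≠ r :=
  ae_restrict_of_ae (compl_mem_ae_iff.2 (measure_singleton r))

lemma integrableOn_inner_singField {V K : Set Space} (e : ℝ) (r : Space) {E : Space → Space}
    (hK : IsCompact K) (hE : ContinuousOn E K) (hV : MeasurableSet V) (hVK : V ⊆ K) :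
    IntegrableOn (fun x => inner ℝ (singField e r x) (E x)) V := by
  have h1 : IntegrableOn (fun x => ‖singField e r x‖ * ‖E x‖) K :=
    IntegrableOn.mul_continuousOn
      (((locallyIntegrable_singField e r).integrableOn_isCompact hK).norm) hE.norm hK
  refine (h1.mono_set hVK).mono' ?_ (ae_of_all _ fun x => norm_inner_le_norm _ _)
  exact (measurable_singField e r).aestronglyMeasurable.inner
    ((hE.mono hVK).aestronglyMeasurable hV)

lemma integrableOn_mul_inner_singField {V : Set Space} (e : ℝ) (r : Space)
    {E : Space → Space} (hE : ContinuousOn E V) {η : Space → ℝ} (hη : Continuous η)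
    (hc : HasCompactSupport η) (hηV : tsupport η ⊆ V) :
    IntegrableOn (fun x => η x * inner ℝ (singField e r x) (E x)) V := by
  have h1 := integrableOn_inner_singField e r hc (hE.mono hηV) (isClosed_tsupport η).measurableSet
    subset_rfl
  have h2 : IntegrableOn (fun x => η x * inner ℝ (singField e r x) (E x)) (tsupport η) :=
    h1.continuousOn_mul hη.continuousOn hc
  exact ((integrableOn_iff_integrable_of_support_subset fun x hx => by
    by_contra h; exact hx (by simp [image_eq_zero_of_notMem_tsupport h])).1 h2).integrableOn

lemma integrableOn_singPotential_mul {V : Set Space} (e : ℝ) (r : Space)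
    {E : Space → Space} (hE : ContinuousOn E V) {η : Space → ℝ} (hη : ContDiff ℝ 1 η)
    (hc : HasCompactSupport η) (hηV : tsupport η ⊆ V) :
    IntegrableOn (fun x => singPotential e r x * fderiv ℝ η x (E x)) V := by
  have h1 : IntegrableOn (fun x => singPotential e r x * fderiv ℝ η x (E x)) (tsupport η) :=
    ((locallyIntegrable_singPotential e r).integrableOn_isCompact hc).mul_continuousOn
      ((hη.continuous_fderiv one_ne_zero).continuousOn.clm_apply (hE.mono hηV)) hc
  exact ((integrableOn_iff_integrable_of_support_subset fun x hx => by
    by_contra h; exact hx (by simp [fderiv_of_notMem_tsupport (𝕜 := ℝ) h])).1 h1).integrableOn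

/-- A harmonic field is orthogonal to the gradient of a localized Coulomb potential. -/
lemma IsHarmonicField.integral_localized_singPotential {V : Set Space} (hV : IsOpen V)
    {v : Space → ℝ} {E : Space → Space} (h : IsHarmonicField V v E) (e : ℝ) (r : Space)
    {η : Space → ℝ} (hη : ContDiff ℝ 1 η) (hc : HasCompactSupport η) (hηV : tsupport η ⊆ V) :
    ∫ x in V, singPotential e r x * fderiv ℝ η x (E x) =
      ∫ x in V, η x * inner ℝ (singField e r x) (E x) := by
  have hE : ContinuousOn E V := h.continuousOn_field.mono subset_closure
  have i1 := integrableOn_singPotential_mul e r hE hη hc hηV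
  have i2 := integrableOn_mul_inner_singField e r hE hη.continuous hc hηV
  have hEm : AEStronglyMeasurable E (volume.restrict V) := hE.aestronglyMeasurable hV.measurableSet
  have hηE : AEStronglyMeasurable (fun x => fderiv ℝ η x (E x)) (volume.restrict V) :=
    (((hη.continuous_fderiv one_ne_zero).continuousOn).clm_apply hE).aestronglyMeasurable
      hV.measurableSet
  rw [← sub_eq_zero, ← integral_sub i1 i2]
  -- The localized Coulomb potential is not an admissible test function, but its smoothed versions
  -- are. They are dominated by the singular expressions, which are integrable, so the limit `ε → 0`
  -- is legitimate.
  set ε : ℕ → ℝ := fun n => 1 / ((n : ℝ) + 1) with hε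
  have hε0 : ∀ n, 0 < ε n := fun n => by positivity
  have hεt : Tendsto ε atTop (𝓝 0) := tendsto_one_div_add_atTop_nhds_zero_nat
  have hz : ∀ n, ∫ x in V, (smoothedPotential e (ε n) r x * fderiv ℝ η x (E x) -
      η x * inner ℝ (smoothedField e (ε n) r x) (E x)) = 0 := by
    intro n
    have hpos : ∀ x : Space, 0 < ‖x - r‖ ^ 2 + ε n := fun x => by have := hε0 n; positivity
    have hs : ContDiff ℝ 1 (smoothedPotential e (ε n) r) :=
      contDiff_iff_contDiffAt.2 fun x => contDiffAt_smoothedPotential e (hpos x)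
    have hw := h.weak (fun x => η x * smoothedPotential e (ε n) r x) (hη.mul hs) hc.mul_right
      ((tsupport_mul_subset_left).trans hηV)
    rw [← hw]
    refine integral_congr_ae (ae_of_all _ fun x => ?_)
    simp only []
    rw [fderiv_fun_mul (hη.differentiable one_ne_zero x) (hs.differentiable one_ne_zero x)]
    simp only [_root_.add_apply, _root_.smul_apply, smul_eq_mul,
      fderiv_smoothedPotential e (hpos x)]
    ring
  refine tendsto_nhds_unique (l := atTop) (f := fun n => ∫ x in V, (smoothedPotential e (ε n) r x *
    fderiv ℝ η x (E x) - η x * inner ℝ (smoothedField e (ε n) r x) (E x))) ?_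
    (by simp only [hz]; exact tendsto_const_nhds)
  refine tendsto_integral_of_dominated_convergence
    (fun x => ‖singPotential e r x * fderiv ℝ η x (E x)‖ + |η x| * (‖singField e r x‖ * ‖E x‖))
    (fun n => ?_) ?_ (fun n => ?_) ?_
  · exact ((measurable_smoothedPotential e (ε n) r).aestronglyMeasurable.mul hηE).sub
      (hη.continuous.aestronglyMeasurable.mul
        ((measurable_smoothedField e (ε n) r).aestronglyMeasurable.inner hEm))
  · refine i1.norm.add ?_
    have h1 : IntegrableOn (fun x => ‖singField e r x‖ * ‖E x‖) (tsupport η) :=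
      IntegrableOn.mul_continuousOn
      (((locallyIntegrable_singField e r).integrableOn_isCompact hc).norm)
        (hE.mono hηV).norm hc
    have h2 : IntegrableOn (fun x => |η x| * (‖singField e r x‖ * ‖E x‖)) (tsupport η) :=
      h1.continuousOn_mul hη.continuous.abs.continuousOn hc
    exact ((integrableOn_iff_integrable_of_support_subset fun x hx => by
      by_contra h; exact hx (by simp [image_eq_zero_of_notMem_tsupport h])).1 h2).integrableOn
  · filter_upwards [ae_ne_point r V] with x hx
    refine (norm_sub_le _ _).trans (add_le_add ?_ ?_)
    · rw [norm_mul, norm_mul]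
      exact mul_le_mul_of_nonneg_right (abs_smoothedPotential_le e (hε0 n).le hx) (norm_nonneg _)
    · rw [norm_mul]
      refine mul_le_mul_of_nonneg_left ((norm_inner_le_norm _ _).trans ?_) (norm_nonneg _)
      exact mul_le_mul_of_nonneg_right (norm_smoothedField_le e (hε0 n).le hx) (norm_nonneg _)
  · filter_upwards [ae_ne_point r V] with x hx
    exact (((tendsto_smoothedPotential e hx).comp hεt).mul_const _).sub
      ((((tendsto_smoothedField e hx).comp hεt).inner tendsto_const_nhds).const_mul _)

/-! ### Boundary layers and a divergence theorem for tangential fields. -/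

/-- A set that is disjoint from its translates by at least `τ` in a direction is thin. -/
lemma measureReal_le_of_translates {S : Set Space} (hS : MeasurableSet S) {x : Space} {s : ℝ}
    (hs : 0 < s) (hSx : S ⊆ ball x s) {v : Space} (hv : ‖v‖ = 1) {τ : ℝ} (hτ : 0 < τ)
    (h : ∀ y ∈ S, ∀ t ≥ τ, y + t • v ∉ S) :
    volume.real S ≤ τ * (volume.real (ball x (2 * s)) / s) := by
  -- The shifts `k * τ` with `k ≤ N` are at most `s`, so the `N + 1 > s / τ` disjoint translates all
  -- fit into the ball of radius `2 * s`.
  set N := ⌊s / τ⌋₊ with hN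
  set T : ℕ → Set Space := fun k => (fun y => y - (k * τ) • v) ⁻¹' S with hT
  have hTm : ∀ k, MeasurableSet (T k) := fun k => (measurable_sub_const _) hS
  have hTv : ∀ k, volume.real (T k) = volume.real S := fun k => by
    simp only [measureReal_def, hT, sub_eq_add_neg]
    rw [measure_preimage_add_right]
  have hlt : ∀ k l : ℕ, k < l → Disjoint (T k) (T l) := by
    intro k l hkl
    rw [Set.disjoint_left]
    intro y hk hl
    have h1 : (k : ℝ) + 1 ≤ l := by exact_mod_cast hkl
    refine h _ hl (((l : ℝ) - k) * τ) (by nlinarith) ?_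
    have : y - (l * τ) • v + (((l : ℝ) - k) * τ) • v = y - (k * τ) • v := by
      rw [sub_mul, sub_smul]
      abel
    rw [this]
    exact hk
  have hd : Set.PairwiseDisjoint (↑(Finset.range (N + 1))) T := fun k _ l _ hkl => by
    rcases lt_or_gt_of_ne hkl with h' | h'
    · exact hlt k l h'
    · exact (hlt l k h').symm
  have hsub : (⋃ k ∈ Finset.range (N + 1), T k) ⊆ ball x (2 * s) := by
    intro y hy
    simp only [mem_iUnion, Finset.mem_range] at hy
    obtain ⟨k, hk, hy⟩ := hy
    have h1 : (k : ℝ) ≤ N := by exact_mod_cast Nat.lt_succ_iff.1 hk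
    have h2 : (N : ℝ) ≤ s / τ := Nat.floor_le (by positivity)
    have h3 : (k : ℝ) * τ ≤ s := (le_div_iff₀ hτ).1 (h1.trans h2)
    have h4 : dist (y - (k * τ) • v) x < s := hSx hy
    have h5 : dist y (y - (k * τ) • v) = k * τ := by
      rw [dist_eq_norm, sub_sub_cancel, norm_smul, hv, mul_one, Real.norm_of_nonneg (by positivity)]
    rw [mem_ball]
    linarith [dist_triangle y (y - (k * τ) • v) x]
  have h6 := measureReal_mono hsub (measure_ball_lt_top (μ := volume)).ne
  rw [measureReal_biUnion_finset hd (fun k _ => hTm k) fun k hk =>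
    measure_ne_top_of_subset ((subset_biUnion_of_mem (u := T) hk).trans hsub)
      (measure_ball_lt_top (μ := volume)).ne] at h6
  simp only [hTv, Finset.sum_const, Finset.card_range, nsmul_eq_mul] at h6
  have h7 : s / τ < (N + 1 : ℕ) := by
    push_cast
    exact Nat.lt_floor_add_one _
  rw [div_lt_iff₀ hτ] at h7
  rw [← mul_div_assoc, le_div_iff₀ hs]
  have h8 : 0 ≤ volume.real S := measureReal_nonneg
  nlinarith

/-- The part of a ball in which a function with slope at least `c` takes values in an interval of
length `l` has volume at most of order `l`. -/
lemma measureReal_layer_le {ρ : Space → ℝ} {x v : Space} {s c : ℝ} (hs : 0 < s) (hc : 0 < c)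
    (hv : ‖v‖ = 1) (hρ : ContDiffOn ℝ 1 ρ (ball x s))
    (hslope : ∀ y ∈ ball x s, c ≤ fderiv ℝ ρ y v) (α : ℝ) {l : ℝ} (hl : 0 < l) :
    MeasurableSet (ball x s ∩ ρ ⁻¹' Ioo (α - l) α) ∧
    volume.real (ball x s ∩ ρ ⁻¹' Ioo (α - l) α) ≤
      l * (volume.real (ball x (2 * s)) / (s * c)) := by
  have hm : MeasurableSet (ball x s ∩ ρ ⁻¹' Ioo (α - l) α) :=
    (hρ.continuousOn.isOpen_inter_preimage isOpen_ball isOpen_Ioo).measurableSet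
  refine ⟨hm, (measureReal_le_of_translates hm hs inter_subset_left hv
    (div_pos hl hc) ?_).trans_eq (by field_simp)⟩
  -- Moving by at least `l / c` along `v` raises `ρ` by at least `l`, hence leaves the open
  -- interval; convexity of the ball keeps the segment where the slope bound holds.
  rintro y ⟨hy, hy'⟩ t ht ⟨hz, hz'⟩
  have ht0 : 0 < t := (div_pos hl hc).trans_le ht
  have hseg : ∀ u ∈ Icc (0 : ℝ) t, y + u • v ∈ ball x s := by
    intro u hu
    have h1 := (convex_ball x s).add_smul_sub_mem hy hz (t := u / t)
      ⟨div_nonneg hu.1 ht0.le, (div_le_one ht0).2 hu.2⟩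
    rwa [add_sub_cancel_left, smul_smul, div_mul_cancel₀ _ ht0.ne'] at h1
  have hder : ∀ u ∈ Icc (0 : ℝ) t, HasDerivAt (fun u : ℝ => ρ (y + u • v))
      (fderiv ℝ ρ (y + u • v) v) u := by
    intro u hu
    have h1 : HasDerivAt (fun u : ℝ => y + u • v) v u := by
      simpa using ((hasDerivAt_id u).smul_const v).const_add y
    have h2 := (hρ.differentiableOn one_ne_zero).differentiableAt
      (isOpen_ball.mem_nhds (hseg u hu))
    exact h2.hasFDerivAt.comp_hasDerivAt u h1
  have hmv := (convex_Icc (0 : ℝ) t).mul_sub_le_image_sub_of_le_deriv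
    (f := fun u : ℝ => ρ (y + u • v)) (C := c)
    (fun u hu => (hder u hu).continuousAt.continuousWithinAt)
    (fun u hu => (hder u (interior_subset hu)).differentiableAt.differentiableWithinAt)
    (fun u hu => by
      rw [(hder u (interior_subset hu)).deriv]
      exact hslope _ (hseg u (interior_subset hu)))
    0 (left_mem_Icc.2 ht0.le) t (right_mem_Icc.2 ht0.le) ht0.le
  simp only [zero_smul, add_zero, sub_zero] at hmv
  have h3 : l ≤ t * c := (div_le_iff₀ hc).1 ht
  have h4 := hy'.1
  have h5 := hz'.2
  nlinarith

/-- A smooth step from `1` to `0`. -/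
def smoothStep (t : ℝ) : ℝ := Real.smoothTransition (-t - 1)

lemma contDiff_smoothStep {n : ℕ∞} : ContDiff ℝ n smoothStep :=
  Real.smoothTransition.contDiff.comp (by fun_prop)

lemma smoothStep_of_le {t : ℝ} (h : t ≤ -2) : smoothStep t = 1 :=
  Real.smoothTransition.one_of_one_le (by linarith)

lemma smoothStep_of_ge {t : ℝ} (h : -1 ≤ t) : smoothStep t = 0 :=
  Real.smoothTransition.zero_of_nonpos (by linarith)

lemma abs_smoothStep_le (t : ℝ) : |smoothStep t| ≤ 1 :=
  abs_le.2 ⟨(neg_nonpos.2 zero_le_one).trans (Real.smoothTransition.nonneg _),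
    Real.smoothTransition.le_one _⟩

/-- The transition takes place between `-2` and `-1`; the wider interval leaves room for the step to
be constant near every excluded point. -/
lemma deriv_smoothStep_eq_zero {t : ℝ} (h : t ∉ Ioo (-3 : ℝ) 0) : deriv smoothStep t = 0 := by
  rw [mem_Ioo, not_and_or, not_lt, not_lt] at h
  rcases h with h | h
  · have : smoothStep =ᶠ[𝓝 t] fun _ => 1 := by
      filter_upwards [Iio_mem_nhds (show t < -2 by linarith)] with u hu
      exact smoothStep_of_le (le_of_lt hu)
    rw [this.deriv_eq, deriv_const]
  · have : smoothStep =ᶠ[𝓝 t] fun _ => 0 := by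
      filter_upwards [Ioi_mem_nhds (show -1 < t by linarith)] with u hu
      exact smoothStep_of_ge (le_of_lt hu)
    rw [this.deriv_eq, deriv_const]

lemma exists_bound_deriv_smoothStep : ∃ M : ℝ, 0 ≤ M ∧ ∀ t, |deriv smoothStep t| ≤ M := by
  obtain ⟨M, hM⟩ := isCompact_Icc.exists_bound_of_continuousOn (s := Icc (-3 : ℝ) 0)
    ((contDiff_smoothStep (n := 1)).continuous_deriv le_rfl).continuousOn
  refine ⟨max M 0, le_max_right _ _, fun t => ?_⟩
  by_cases h : t ∈ Ioo (-3 : ℝ) 0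
  · exact (hM t (Ioo_subset_Icc_self h)).trans (le_max_left _ _)
  · rw [deriv_smoothStep_eq_zero h, abs_zero]
    exact le_max_right _ _

lemma integrableOn_mul_add_fderiv {V : Set Space} {a : Space → ℝ} {b : Space → Space}
    (ha : IntegrableOn a V) (hb : IntegrableOn b V) {η : Space → ℝ} (hη : ContDiff ℝ 1 η)
    (hc : HasCompactSupport η) :
    IntegrableOn (fun y => η y * a y + fderiv ℝ η y (b y)) V := by
  have hη' := hη.continuous_fderiv one_ne_zero
  obtain ⟨C, hC⟩ := hη'.norm.bddAbove_range_of_hasCompactSupport (hc.fderiv ℝ).norm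
  obtain ⟨C', hC'⟩ := hη.continuous.norm.bddAbove_range_of_hasCompactSupport hc.norm
  refine Integrable.add ?_ ?_
  · exact ha.bdd_mul hη.continuous.aestronglyMeasurable (ae_of_all _ fun y => hC' ⟨y, rfl⟩)
  · refine (hb.norm.const_mul C).mono' ?_ (ae_of_all _ fun y => ?_)
    · exact isBoundedBilinearMap_apply.continuous.comp_aestronglyMeasurable
        (hη'.aestronglyMeasurable.prodMk hb.aestronglyMeasurable)
    · exact ((fderiv ℝ η y).le_opNorm _).trans
        (mul_le_mul_of_nonneg_right (hC ⟨y, rfl⟩) (norm_nonneg _))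

/-- The cutoff near the boundary `{ρ = 0}` of a function supported in a ball. -/
lemma contDiff_mul_smoothStep {V : Set Space} {x : Space} {s : ℝ} {ρ : Space → ℝ}
    (hρ : ContDiffOn ℝ 1 ρ (ball x s)) (hVρ : V ∩ ball x s = {y | y ∈ ball x s ∧ ρ y < 0})
    {ζ : Space → ℝ} (hζ : ContDiff ℝ 1 ζ) (hζs : tsupport ζ ⊆ ball x s) {ε : ℝ} (hε : 0 < ε) :
    ContDiff ℝ 1 (fun y => ζ y * smoothStep (ρ y / ε)) ∧
    HasCompactSupport (fun y => ζ y * smoothStep (ρ y / ε)) ∧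
    tsupport (fun y => ζ y * smoothStep (ρ y / ε)) ⊆ V ∩ ball x s := by
  have hρε : ContDiffOn ℝ 1 (fun y => smoothStep (ρ y / ε)) (ball x s) :=
    (contDiff_smoothStep (n := 1)).comp_contDiffOn (hρ.div_const ε)
  have hζc : HasCompactSupport ζ :=
    Metric.isCompact_of_isClosed_isBounded (isClosed_tsupport ζ) (isBounded_ball.subset hζs)
  refine ⟨contDiff_mul_of_tsupport_subset isOpen_ball hζ hζs hρε, hζc.mul_right, fun y hy => ?_⟩
  have hyB : y ∈ ball x s := hζs (tsupport_mul_subset_left hy)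
  rw [hVρ]
  refine ⟨hyB, ?_⟩
  by_contra hneg
  rw [not_lt] at hneg
  have hcont := hρ.continuousOn.continuousAt (isOpen_ball.mem_nhds hyB)
  have h1 : (fun y => ζ y * smoothStep (ρ y / ε)) =ᶠ[𝓝 y] 0 := by
    filter_upwards [hcont.eventually (lt_mem_nhds (show -ε < ρ y by linarith))] with z hz
    rw [smoothStep_of_ge, mul_zero, Pi.zero_apply]
    rw [le_div_iff₀ hε]
    linarith
  exact (notMem_tsupport_iff_eventuallyEq.2 h1) hy

/-- A field with divergence `a` which is tangential on the boundary piece `{ρ = 0}` has no flux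
through that piece. -/
lemma integral_eq_zero_of_tangential {V : Set Space} (hV : IsOpen V)
    {a : Space → ℝ} {b : Space → Space} (ha : IntegrableOn a V) (hb : IntegrableOn b V)
    {x v : Space} {s c : ℝ} (hs : 0 < s) (hc : 0 < c) (hv : ‖v‖ = 1) {ρ : Space → ℝ}
    (hρ : ContDiffOn ℝ 1 ρ (ball x s)) (hVρ : V ∩ ball x s = {y | y ∈ ball x s ∧ ρ y < 0})
    (hslope : ∀ y ∈ ball x s, c ≤ fderiv ℝ ρ y v)
    (hbc : ContinuousOn b (closure V ∩ ball x s))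
    (htan : ∀ y ∈ frontier V ∩ ball x s, fderiv ℝ ρ y (b y) = 0)
    (hweak : ∀ η : Space → ℝ, ContDiff ℝ 1 η → HasCompactSupport η → tsupport η ⊆ V ∩ ball x s →
      ∫ y in V, (η y * a y + fderiv ℝ η y (b y)) = 0)
    {ζ : Space → ℝ} (hζ : ContDiff ℝ 1 ζ) (hζs : tsupport ζ ⊆ ball x s) :
    ∫ y in V, (ζ y * a y + fderiv ℝ ζ y (b y)) = 0 := by
  set B := V ∩ ball x s with hB
  have hBo : IsOpen B := hV.inter isOpen_ball
  have hζc : HasCompactSupport ζ :=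
    Metric.isCompact_of_isClosed_isBounded (isClosed_tsupport ζ) (isBounded_ball.subset hζs)
  have hneg : ∀ y ∈ B, ρ y < 0 := fun y hy => (hVρ.subset hy).2
  have hres : ∀ η : Space → ℝ, tsupport η ⊆ ball x s →
      ∫ y in V, (η y * a y + fderiv ℝ η y (b y)) =
        ∫ y in B, (η y * a y + fderiv ℝ η y (b y)) := by
    intro η hη
    refine setIntegral_eq_of_subset_of_forall_sdiff_eq_zero hV.measurableSet inter_subset_left ?_
    intro y hy
    have h1 : y ∉ tsupport η := fun h => hy.2 ⟨hy.1, hη h⟩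
    rw [image_eq_zero_of_notMem_tsupport h1, fderiv_of_notMem_tsupport (𝕜 := ℝ) h1]
    simp
  rw [hres ζ hζs]
  set g : Space → ℝ := fun y => ζ y * a y + fderiv ℝ ζ y (b y) with hg
  have hgi : IntegrableOn g B := (integrableOn_mul_add_fderiv ha hb hζ hζc).mono_set inter_subset_left
  set ε : ℕ → ℝ := fun n => 1 / ((n : ℝ) + 1) with hε
  have hε0 : ∀ n, 0 < ε n := fun n => by positivity
  have hεt : Tendsto ε atTop (𝓝 0) := tendsto_one_div_add_atTop_nhds_zero_nat
  -- This is the term in which the derivative falls on the boundary cutoff. The weak identity for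
  -- the cut-off test function turns its integral into one that converges to `-∫ g`, so it suffices
  -- to show that it is arbitrarily small.
  set T : ℕ → Space → ℝ := fun n y =>
    ζ y * (deriv smoothStep (ρ y / ε n) * (fderiv ℝ ρ y (b y) / ε n)) with hT
  have hstepm : ∀ n, ContinuousOn (fun y => smoothStep (ρ y / ε n)) B := fun n =>
    (contDiff_smoothStep (n := 1)).continuous.comp_continuousOn
      ((hρ.continuousOn.mono inter_subset_right).div_const _)
  have hgn : ∀ n, IntegrableOn (fun y => smoothStep (ρ y / ε n) * g y) B := fun n =>
    hgi.bdd_mul ((hstepm n).aestronglyMeasurable hBo.measurableSet)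
      (ae_of_all _ fun y => abs_smoothStep_le _)
  have hT1 : ∀ n, ∫ y in B, T n y = -∫ y in B, smoothStep (ρ y / ε n) * g y := by
    intro n
    obtain ⟨k1, k2, k3⟩ := contDiff_mul_smoothStep hρ hVρ hζ hζs (hε0 n)
    have h1 := hweak _ k1 k2 k3
    rw [hres _ (k3.trans inter_subset_right)] at h1
    have h2 := (integrableOn_mul_add_fderiv ha hb k1 k2).mono_set
      (inter_subset_left : B ⊆ V)
    rw [← zero_sub, ← h1, ← integral_sub h2 (hgn n)]
    refine setIntegral_congr_fun hBo.measurableSet fun y hy => ?_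
    have hd : HasFDerivAt (fun y => smoothStep (ρ y / ε n))
        (deriv smoothStep (ρ y / ε n) • (ε n)⁻¹ • fderiv ℝ ρ y) y := by
      have e1 := ((hρ.differentiableOn one_ne_zero).differentiableAt
        (isOpen_ball.mem_nhds hy.2)).hasFDerivAt
      have e2 : HasFDerivAt (fun y => ρ y / ε n) ((ε n)⁻¹ • fderiv ℝ ρ y) y := by
        simpa [div_eq_mul_inv] using e1.mul_const (ε n)⁻¹
      exact (((contDiff_smoothStep (n := 1)).differentiable one_ne_zero
        _).hasDerivAt).comp_hasFDerivAt y e2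
    have hp := ((hζ.differentiable one_ne_zero y).hasFDerivAt.mul hd).fderiv
    simp only [hT, hg]
    erw [hp]
    simp only [_root_.add_apply, _root_.smul_apply, smul_eq_mul]
    ring
  have hlim : Tendsto (fun n => ∫ y in B, T n y) atTop (𝓝 (-∫ y in B, g y)) := by
    simp only [hT1]
    refine Tendsto.neg (tendsto_integral_of_dominated_convergence (fun y => ‖g y‖)
      (fun n => (hgn n).aestronglyMeasurable) hgi.norm (fun n => ae_of_all _ fun y => ?_) ?_)
    · rw [norm_mul]
      exact mul_le_of_le_one_left (norm_nonneg _) (abs_smoothStep_le _)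
    · filter_upwards [ae_restrict_mem hBo.measurableSet] with y hy
      refine tendsto_const_nhds.congr' ?_
      have h1 : ∀ᶠ n in atTop, ε n < -ρ y / 2 :=
        hεt.eventually (gt_mem_nhds (by linarith [hneg y hy]))
      filter_upwards [h1] with n hn
      rw [smoothStep_of_le, one_mul]
      rw [div_le_iff₀ (hε0 n)]
      linarith
  obtain ⟨M, hM0, hM⟩ := exists_bound_deriv_smoothStep
  obtain ⟨Z, hZ⟩ := hζ.continuous.norm.bddAbove_range_of_hasCompactSupport hζc.norm
  have hZ0 : 0 ≤ Z := (norm_nonneg _).trans (hZ ⟨x, rfl⟩)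
  -- On the layer `-3 ε < ρ < 0` the normal component of `b` is at most `τ` for small `ε`, so the
  -- integrand is at most `Z * M * τ / ε`, while the layer has volume of order `3 ε`. The powers of
  -- `ε` cancel.
  have hbound : ∀ τ > 0, |∫ y in B, g y| ≤ τ * (Z * M * 3 * (volume.real (ball x (2 * s)) / (s * c))) := by
    intro τ hτ
    set β : Space → ℝ := fun y => fderiv ℝ ρ y (b y)
    have hβ : ContinuousOn β (closure V ∩ tsupport ζ) :=
      ((hρ.continuousOn_fderiv_of_isOpen isOpen_ball le_rfl).mono
        (inter_subset_right.trans hζs)).clm_apply (hbc.mono (inter_subset_inter_right _ hζs))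
    have hCc : IsCompact (closure V ∩ tsupport ζ) := hζc.inter_left isClosed_closure
    have hDc : IsCompact ((closure V ∩ tsupport ζ) ∩ (fun y => |β y|) ⁻¹' Ici τ) := by
      exact hCc.of_isClosed_subset (hβ.abs.preimage_isClosed_of_isClosed hCc.isClosed isClosed_Ici)
        inter_subset_left
    -- The points of the compact support where `|β| ≥ τ` avoid the frontier by tangency, so `ρ` has
    -- a negative maximum there; minus this maximum serves as `δ`.
    obtain ⟨δ, hδ, hsmall⟩ : ∃ δ > 0, ∀ y ∈ B, y ∈ tsupport ζ → -δ < ρ y → |β y| ≤ τ := by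
      rcases ((closure V ∩ tsupport ζ) ∩ (fun y => |β y|) ⁻¹' Ici τ).eq_empty_or_nonempty with h | h
      · refine ⟨1, one_pos, fun y hy hyζ _ => ?_⟩
        by_contra hcon
        have : y ∈ (closure V ∩ tsupport ζ) ∩ (fun y => |β y|) ⁻¹' Ici τ :=
          ⟨⟨subset_closure hy.1, hyζ⟩, (not_le.1 hcon).le⟩
        rw [h] at this
        exact this
      · obtain ⟨y₀, hy₀, hmax⟩ := hDc.exists_isMaxOn h
          (hρ.continuousOn.mono ((inter_subset_left.trans inter_subset_right).trans hζs))
        have hy0B := hζs hy₀.1.2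
        have hy0neg : ρ y₀ < 0 := by
          by_contra hcon
          have h1 : y₀ ∈ frontier V := by
            rw [hV.frontier_eq]
            exact ⟨hy₀.1.1, fun h => hcon (hneg y₀ ⟨h, hy0B⟩)⟩
          have h2 : τ ≤ |β y₀| := hy₀.2
          simp only [β, htan y₀ ⟨h1, hy0B⟩, abs_zero] at h2
          linarith
        refine ⟨-ρ y₀, by linarith, fun y hy hyζ hyρ => ?_⟩
        by_contra hcon
        have h1 : ρ y ≤ ρ y₀ := hmax ⟨⟨subset_closure hy.1, hyζ⟩, (not_le.1 hcon).le⟩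
        linarith
    rw [← abs_neg]
    refine le_of_tendsto hlim.abs ?_
    filter_upwards [hεt.eventually (gt_mem_nhds (show (0 : ℝ) < δ / 3 by positivity))] with n hn
    have hn0 := hε0 n
    obtain ⟨hLm, hL⟩ := measureReal_layer_le hs hc hv hρ hslope 0 (l := 3 * ε n) (by positivity)
    set S := ball x s ∩ ρ ⁻¹' Ioo (0 - 3 * ε n) 0
    have hTz : ∀ y ∈ B \ (B ∩ S), T n y = 0 := by
      intro y hy
      have h1 : ρ y / ε n ∉ Ioo (-3 : ℝ) 0 := by
        intro h
        refine hy.2 ⟨hy.1, hy.1.2, ?_, hneg y hy.1⟩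
        have := (lt_div_iff₀ hn0).1 h.1
        linarith
      simp only [hT, deriv_smoothStep_eq_zero h1]
      ring
    rw [setIntegral_eq_of_subset_of_forall_sdiff_eq_zero hBo.measurableSet
      (inter_subset_left : B ∩ S ⊆ B) hTz]
    have hSfin : volume S < ⊤ := (measure_mono inter_subset_left).trans_lt measure_ball_lt_top
    have hbd := norm_setIntegral_le_of_norm_le_const (f := T n) (μ := volume) (s := B ∩ S)
      (C := Z * M * (τ / ε n)) ((measure_mono inter_subset_right).trans_lt hSfin) (fun y hy => by
        by_cases hyζ : y ∈ tsupport ζ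
        · have h1 := hsmall y hy.1 hyζ (by have := hy.2.2.1; linarith)
          simp only [hT, norm_mul, mul_assoc]
          refine mul_le_mul (hZ ⟨y, rfl⟩) (mul_le_mul (hM _) ?_ (norm_nonneg _) hM0)
            (by positivity) hZ0
          rw [norm_div, Real.norm_of_nonneg hn0.le]
          exact div_le_div_of_nonneg_right h1 hn0.le
        · simp only [hT, image_eq_zero_of_notMem_tsupport hyζ, zero_mul, norm_zero]
          positivity)
    refine hbd.trans ?_
    have h2 : volume.real (B ∩ S) ≤ 3 * ε n * (volume.real (ball x (2 * s)) / (s * c)) :=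
      (measureReal_mono inter_subset_right hSfin.ne).trans hL
    calc Z * M * (τ / ε n) * volume.real (B ∩ S)
        ≤ Z * M * (τ / ε n) * (3 * ε n * (volume.real (ball x (2 * s)) / (s * c))) := by gcongr
      _ = _ := by field_simp
  have hK : 0 ≤ Z * M * 3 * (volume.real (ball x (2 * s)) / (s * c)) := by positivity
  set K := Z * M * 3 * (volume.real (ball x (2 * s)) / (s * c))
  have : |∫ y in B, g y| ≤ 0 := by
    refine le_of_forall_pos_le_add fun δ hδ => ?_
    refine (hbound (δ / (K + 1)) (by positivity)).trans ?_
    rw [zero_add, div_mul_eq_mul_div, div_le_iff₀ (by positivity)]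
    nlinarith
  exact abs_eq_zero.1 (le_antisymm this (abs_nonneg _))

/-- On a small ball one defining function has slope at least half of `‖gradient ρ x‖` in the fixed
direction normal at `x`. The same function supplies the normal at every frontier point of the ball,
so tangency there means `fderiv ℝ ρ y (b y) = 0`. The ball also avoids `F`, so test functions
supported in it see no flux from `F`. -/
lemma exists_ball_tangential {V : Set Space} (hV : IsOpen V) (hVC : HasC1Boundary V)
    {F : Set Space} (hF : IsClosed F) (hFV : F ⊆ V) {a : Space → ℝ} {b : Space → Space}
    (ha : IntegrableOn a V) (hb : IntegrableOn b V) (hbc : ContinuousOn b (closure V \ F))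
    (htan : ∀ x n : Space, IsOutwardUnitNormal V x n → inner ℝ (b x) n = 0)
    (hweak : ∀ η : Space → ℝ, ContDiff ℝ 1 η → HasCompactSupport η → tsupport η ⊆ V →
      (∀ᶠ y in 𝓝ˢ F, η y = 0) → ∫ y in V, (η y * a y + fderiv ℝ η y (b y)) = 0)
    {x : Space} (hx : x ∈ frontier V) :
    ∃ s > 0, Disjoint F (ball x s) ∧ ∀ ζ : Space → ℝ, ContDiff ℝ 1 ζ → tsupport ζ ⊆ ball x s →
      ∫ y in V, (ζ y * a y + fderiv ℝ ζ y (b y)) = 0 := by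
  obtain ⟨W, ρ, hxW, hdef⟩ := hVC x hx
  have hdef' := hdef
  obtain ⟨hWo, hρ, hgrad, hVW⟩ := hdef
  set v : Space := ‖gradient ρ x‖⁻¹ • gradient ρ x with hvdef
  have hg0 : 0 < ‖gradient ρ x‖ := norm_pos_iff.2 (hgrad x hxW)
  have hv : ‖v‖ = 1 := by rw [hvdef, norm_smul, norm_inv, norm_norm, inv_mul_cancel₀ hg0.ne']
  have hgv : fderiv ℝ ρ x v = ‖gradient ρ x‖ := by
    rw [← inner_gradient_left, hvdef, inner_smul_right, real_inner_self_eq_norm_sq]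
    field_simp
  have hcont : ContinuousAt (fun y => fderiv ℝ ρ y v) x :=
    ((hρ.continuousOn_fderiv_of_isOpen hWo le_rfl).clm_apply continuousOn_const).continuousAt
      (hWo.mem_nhds hxW)
  have hxF : x ∉ F := fun h => by
    rw [hV.frontier_eq] at hx
    exact hx.2 (hFV h)
  have hnhds : {y | ‖gradient ρ x‖ / 2 < fderiv ℝ ρ y v} ∩ (W ∩ Fᶜ) ∈ 𝓝 x :=
    inter_mem (hcont.eventually (lt_mem_nhds ((half_lt_self hg0).trans_eq hgv.symm)))
      (inter_mem (hWo.mem_nhds hxW) (hF.isOpen_compl.mem_nhds hxF))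
  obtain ⟨s, hs, hball⟩ := Metric.mem_nhds_iff.1 hnhds
  have hsW : ball x s ⊆ W := fun y hy => (hball hy).2.1
  have hsF : Disjoint F (ball x s) :=
    Set.disjoint_right.2 fun y hy => (hball hy).2.2
  refine ⟨s, hs, hsF, fun ζ hζ hζs => ?_⟩
  refine integral_eq_zero_of_tangential hV ha hb hs (half_pos hg0) hv (hρ.mono hsW) ?_
    (fun y hy => (hball hy).1.le) (hbc.mono fun y hy => ⟨hy.1, (hball hy.2).2.2⟩) ?_ ?_ hζ hζs
  · ext y
    constructor
    · rintro ⟨h1, h2⟩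
      exact ⟨h2, (hVW.subset ⟨h1, hsW h2⟩).2⟩
    · rintro ⟨h1, h2⟩
      exact ⟨(hVW.superset ⟨hsW h1, h2⟩).1, h1⟩
  · rintro y ⟨hyf, hyB⟩
    have h1 := htan y _ ⟨hyf, W, ρ, hsW hyB, hdef', rfl⟩
    rw [inner_smul_right, inner_gradient_right, conj_trivial] at h1
    exact (mul_eq_zero.1 h1).resolve_left
      (inv_ne_zero (norm_ne_zero_iff.2 (hgrad y (hsW hyB))))
  · intro η h1 h2 h3
    refine hweak η h1 h2 (h3.trans inter_subset_left) ?_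
    have h4 : F ⊆ (tsupport η)ᶜ := fun y hy h =>
      Set.disjoint_left.1 hsF hy (h3 h).2
    filter_upwards [(isClosed_tsupport η).isOpen_compl.mem_nhdsSet.2 h4] with y hy
    exact image_eq_zero_of_notMem_tsupport hy

/-- The divergence theorem for a field `b` of divergence `a` in `V ∖ F` which is tangential on the
boundary: the integral of `a` is the flux `c` through a surface around `F`. -/
theorem integral_eq_of_tangential {V : Set Space} (hV : IsOpen V) (hVb : Bornology.IsBounded V)
    (hVC : HasC1Boundary V) {F : Set Space} (hF : IsClosed F) (hFV : F ⊆ V)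
    {a : Space → ℝ} {b : Space → Space} (ha : IntegrableOn a V) (hb : IntegrableOn b V)
    (hbc : ContinuousOn b (closure V \ F))
    (htan : ∀ x n : Space, IsOutwardUnitNormal V x n → inner ℝ (b x) n = 0) {c : ℝ}
    (hweak : ∀ η : Space → ℝ, ContDiff ℝ 1 η → HasCompactSupport η → tsupport η ⊆ V →
      ∀ t : ℝ, (∀ᶠ y in 𝓝ˢ F, η y = t) → ∫ y in V, (η y * a y + fderiv ℝ η y (b y)) = t * c) :
    ∫ y in V, a y = c := by
  have hex := fun (x : Space) (hx : x ∈ frontier V) =>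
    exists_ball_tangential hV hVC hF hFV ha hb hbc htan
      (fun η h1 h2 h3 h4 => by rw [hweak η h1 h2 h3 0 h4, zero_mul]) hx
  choose! s hs hsF hzero using hex
  have hfc : IsCompact (frontier V) :=
    hVb.isCompact_closure.of_isClosed_subset isClosed_frontier frontier_subset_closure
  obtain ⟨t, htf, htc⟩ := hfc.elim_nhds_subcover (fun x => ball x (s x))
    fun x hx => isOpen_ball.mem_nhds (mem_ball_self (hs x hx))
  -- The index `none` is the interior piece and the others are boundary balls. The boundary pieces
  -- contribute nothing and avoid `F`, so the interior function equals `1` near `F` and yields the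
  -- whole flux `c`.
  let U : Option t → Set Space := fun i => i.elim V fun x => ball x.1 (s x.1)
  have hUo : ∀ i, IsOpen (U i) := by
    rintro (_ | x)
    · exact hV
    · exact isOpen_ball
  have hUc : closure V ⊆ ⋃ i, U i := by
    intro y hy
    by_cases hyV : y ∈ V
    · exact mem_iUnion.2 ⟨none, hyV⟩
    · have : y ∈ frontier V := by rw [hV.frontier_eq]; exact ⟨hy, hyV⟩
      obtain ⟨x, hx, hyx⟩ := mem_iUnion₂.1 (htc this)
      exact mem_iUnion.2 ⟨some ⟨x, hx⟩, hyx⟩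
  obtain ⟨f, hf⟩ := SmoothPartitionOfUnity.exists_isSubordinate (modelWithCornersSelf ℝ Space)
    isClosed_closure U hUo hUc
  have hfd : ∀ i, ContDiff ℝ 1 (f i) := fun i =>
    ((f i).contMDiff.contDiff).of_le (by exact_mod_cast le_top)
  have hUb : ∀ i, Bornology.IsBounded (U i) := by
    rintro (_ | x)
    · exact hVb
    · exact isBounded_ball
  have hfc : ∀ i, HasCompactSupport (f i) := fun i =>
    Metric.isCompact_of_isClosed_isBounded (isClosed_tsupport _) ((hUb i).subset (hf i))
  have hsum : ∀ y ∈ V, ∑ i, f i y = 1 := fun y hy => by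
    rw [← finsum_eq_sum_of_fintype]
    exact f.sum_eq_one (subset_closure hy)
  have hdsum : ∀ y ∈ V, ∑ i, fderiv ℝ (f i) y (b y) = 0 := fun y hy => by
    have h1 : (fun z => ∑ i, f i z) =ᶠ[𝓝 y] fun _ => 1 := by
      filter_upwards [hV.mem_nhds hy] with z hz using hsum z hz
    have h2 := h1.fderiv_eq (𝕜 := ℝ)
    rw [fderiv_fun_sum fun i _ => (hfd i).differentiable one_ne_zero y] at h2
    have h3 := congrArg (fun L : Space →L[ℝ] ℝ => L (b y)) h2
    simpa using h3
  have hsplit : ∫ y in V, a y =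
      ∑ i, ∫ y in V, (f i y * a y + fderiv ℝ (f i) y (b y)) := by
    rw [← integral_finsetSum _ fun i _ => integrableOn_mul_add_fderiv ha hb (hfd i) (hfc i)]
    refine setIntegral_congr_fun hV.measurableSet fun y hy => ?_
    rw [Finset.sum_add_distrib, ← Finset.sum_mul, hsum y hy, hdsum y hy, one_mul, add_zero]
  rw [hsplit, Fintype.sum_option, Finset.sum_eq_zero, add_zero]
  · have h1 := hweak (f none) (hfd none) (hfc none) (hf none) 1 ?_
    · rw [h1, one_mul]
    have hFo : F ⊆ V ∩ ⋂ x : t, (tsupport (f (some x)))ᶜ := by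
      intro y hy
      refine ⟨hFV hy, mem_iInter.2 fun x hyx => ?_⟩
      exact Set.disjoint_left.1 (hsF x.1 (htf x.1 x.2)) hy (hf (some x) hyx)
    have hFopen : IsOpen (V ∩ ⋂ x : t, (tsupport (f (some x)))ᶜ) :=
      hV.inter (isOpen_iInter_of_finite fun x => (isClosed_tsupport _).isOpen_compl)
    filter_upwards [hFopen.mem_nhdsSet.2 hFo] with y hy
    have h2 := hsum y hy.1
    rw [Fintype.sum_option, Finset.sum_eq_zero, add_zero] at h2
    · exact h2
    · intro x _
      exact image_eq_zero_of_notMem_tsupport (mem_iInter.1 hy.2 x)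
  · intro x _
    exact hzero x.1 (htf x.1 x.2) _ (hfd _) (hf (some x))

/-! ### Green's formula with point charges. -/

/-- `g` is `C¹` in `V`, and `g` and its gradient `Dg` are continuous up to the boundary. -/
structure HasC1Extension (V : Set Space) (g : Space → ℝ) (Dg : Space → Space) : Prop where
  contDiffOn : ContDiffOn ℝ 1 g V
  continuousOn : ContinuousOn g (closure V)
  continuousOn_gradient : ContinuousOn Dg (closure V)
  fderiv_eq : ∀ x ∈ V, ∀ y, fderiv ℝ g x y = inner ℝ (Dg x) y

lemma _root_.ContDiff.hasC1Extension {g : Space → ℝ} (hg : ContDiff ℝ 1 g) (V : Set Space) :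
    HasC1Extension V g (gradient g) where
  contDiffOn := hg.contDiffOn
  continuousOn := hg.continuous.continuousOn
  continuousOn_gradient :=
    ((InnerProductSpace.toDual ℝ Space).symm.continuous.comp
      (hg.continuous_fderiv one_ne_zero)).continuousOn
  fderiv_eq x _ y := by rw [inner_gradient_left]

lemma IsHarmonicField.hasC1Extension {V : Set Space} {u : Space → ℝ} {D : Space → Space}
    (h : IsHarmonicField V u D) : HasC1Extension V u (fun x => -D x) where
  contDiffOn := h.contDiffOn
  continuousOn := h.continuousOn_potential
  continuousOn_gradient := h.continuousOn_field.neg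
  fderiv_eq x hx y := by rw [h.fderiv_eq x hx, inner_neg_left]

lemma HasC1Extension.differentiableAt {V : Set Space} (hV : IsOpen V) {g : Space → ℝ}
    {Dg : Space → Space} (h : HasC1Extension V g Dg) {x : Space} (hx : x ∈ V) :
    DifferentiableAt ℝ g x :=
  (h.contDiffOn.differentiableOn one_ne_zero).differentiableAt (hV.mem_nhds hx)

lemma HasC1Extension.sub {V : Set Space} (hV : IsOpen V) {g h : Space → ℝ}
    {Dg Dh : Space → Space} (hg : HasC1Extension V g Dg) (hh : HasC1Extension V h Dh) :
    HasC1Extension V (fun x => g x - h x) (fun x => Dg x - Dh x) where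
  contDiffOn := hg.contDiffOn.sub hh.contDiffOn
  continuousOn := hg.continuousOn.sub hh.continuousOn
  continuousOn_gradient := hg.continuousOn_gradient.sub hh.continuousOn_gradient
  fderiv_eq x hx y := by
    rw [fderiv_fun_sub (hg.differentiableAt hV hx) (hh.differentiableAt hV hx),
      _root_.sub_apply, hg.fderiv_eq x hx, hh.fderiv_eq x hx, inner_sub_left]

lemma isHarmonicField_zero (V : Set Space) : IsHarmonicField V (fun _ => 0) (fun _ => 0) where
  contDiffOn := contDiffOn_const
  continuousOn_potential := continuousOn_const
  continuousOn_field := continuousOn_const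
  fderiv_eq x _ y := by simp
  weak ψ _ _ _ := by simp

lemma integrableOn_of_continuousOn_closure {E : Type*} [NormedAddCommGroup E] {V : Set Space}
    (hVb : Bornology.IsBounded V) {f : Space → E} (hf : ContinuousOn f (closure V)) :
    IntegrableOn f V :=
  (hf.integrableOn_compact hVb.isCompact_closure).mono_set subset_closure

lemma continuousOn_singField (e : ℝ) {r : Space} {A : Set Space} (h : r ∉ A) :
    ContinuousOn (singField e r) A := fun x hx =>
  (continuousAt_singField e fun h' : x = r => h (h' ▸ hx)).continuousWithinAt

/-- Green's formula for a field with point charges, without boundary term. -/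
lemma integral_gradient_inner_field {V : Set Space} (hV : IsOpen V)
    (hVb : Bornology.IsBounded V) (hVC : HasC1Boundary V) {v : Space → ℝ} {E : Space → Space}
    (hE : IsHarmonicField V v E) {e₁ e₂ : ℝ} {r₁ r₂ : Space} (h₁ : r₁ ∈ V) (h₂ : r₂ ∈ V)
    {g : Space → ℝ} {Dg : Space → Space} (hg : HasC1Extension V g Dg)
    (htan : ∀ x n : Space, IsOutwardUnitNormal V x n →
      g x * inner ℝ (E x + singField e₁ r₁ x + singField e₂ r₂ x) n = 0) :
    ∫ x in V, inner ℝ (Dg x) (E x + singField e₁ r₁ x + singField e₂ r₂ x) =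
      -(e₁ * g r₁ + e₂ * g r₂) := by
  have hcl := hVb.isCompact_closure
  have hF : IsClosed ({r₁, r₂} : Set Space) := (Set.toFinite _).isClosed
  have hFV : ({r₁, r₂} : Set Space) ⊆ V := by
    rintro x (rfl | rfl) <;> assumption
  set Y : Space → Space := fun x => E x + singField e₁ r₁ x + singField e₂ r₂ x with hY
  have hYi' : IntegrableOn Y (closure V) :=
    ((hE.continuousOn_field.integrableOn_compact hcl).add
      ((locallyIntegrable_singField e₁ r₁).integrableOn_isCompact hcl)).add
      ((locallyIntegrable_singField e₂ r₂).integrableOn_isCompact hcl)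
  have ha : IntegrableOn (fun x => inner ℝ (Dg x) (Y x)) V := by
    have h1 : IntegrableOn (fun x => ‖Y x‖ * ‖Dg x‖) (closure V) :=
      IntegrableOn.mul_continuousOn hYi'.norm hg.continuousOn_gradient.norm hcl
    refine (h1.mono_set subset_closure).mono' ?_ (ae_of_all _ fun x => ?_)
    · exact ((hg.continuousOn_gradient.mono subset_closure).aestronglyMeasurable
        hV.measurableSet).inner (hYi'.mono_set subset_closure).aestronglyMeasurable
    · rw [mul_comm]
      exact norm_inner_le_norm _ _
  have hb : IntegrableOn (fun x => g x • Y x) V :=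
    (hYi'.continuousOn_smul hg.continuousOn hcl).mono_set subset_closure
  -- The field `g • Y` is tangential when either `g` or the normal component of `Y` vanishes at each
  -- boundary point; this one hypothesis serves both boundary conditions. The flux comes from
  -- testing with `η * g`, where `η` is constant near the charges.
  refine integral_eq_of_tangential hV hVb hVC hF hFV ha hb ?_ ?_ ?_
  · refine (hg.continuousOn.mono sdiff_subset).smul (((hE.continuousOn_field.mono sdiff_subset).add
      (continuousOn_singField e₁ ?_)).add (continuousOn_singField e₂ ?_)) <;> simp
  · intro x n hn
    rw [inner_smul_left, conj_trivial]
    exact htan x n hn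
  · intro η h1 h2 h3 t ht
    have hψ := contDiff_mul_of_tsupport_subset hV h1 h3 hg.contDiffOn
    have hψc : HasCompactSupport fun x => η x * g x := h2.mul_right
    have hψV : tsupport (fun x => η x * g x) ⊆ V := tsupport_mul_subset_left.trans h3
    have i1 := integrableOn_fderiv_apply (hE.continuousOn_field.mono subset_closure) hψ hψc hψV
    have i2 := (integral_fderiv_singField_of_hasCompactSupport e₁ r₁ hψ hψc).1.integrableOn (s := V)
    have i3 := (integral_fderiv_singField_of_hasCompactSupport e₂ r₂ hψ hψc).1.integrableOn (s := V)
    have i12 : IntegrableOn (fun x => fderiv ℝ (fun x => η x * g x) x (E x) +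
      fderiv ℝ (fun x => η x * g x) x (singField e₁ r₁ x)) V := i1.add i2
    have hcongr : ∀ x ∈ V, η x * inner ℝ (Dg x) (Y x) + fderiv ℝ η x (g x • Y x) =
        fderiv ℝ (fun x => η x * g x) x (E x) + fderiv ℝ (fun x => η x * g x) x (singField e₁ r₁ x)
          + fderiv ℝ (fun x => η x * g x) x (singField e₂ r₂ x) := by
      intro x hx
      rw [← map_add, ← map_add, fderiv_fun_mul (h1.differentiable one_ne_zero x)
        (hg.differentiableAt hV hx)]
      simp only [_root_.add_apply, _root_.smul_apply, smul_eq_mul, map_smul, hY,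
        hg.fderiv_eq x hx]
    rw [setIntegral_congr_fun hV.measurableSet hcongr, integral_add i12 i3,
      integral_add i1 i2, hE.weak _ hψ hψc hψV, setIntegral_fderiv_singField e₁ r₁ hψ hψc hψV,
      setIntegral_fderiv_singField e₂ r₂ hψ hψc hψV]
    have t1 : η r₁ = t := ht.self_of_nhdsSet _ (by simp)
    have t2 : η r₂ = t := ht.self_of_nhdsSet _ (by simp)
    rw [t1, t2]
    ring

/-! ### Coulomb potentials cut off near the charges. -/

/-- A Coulomb potential cut off near the charge. -/
def farPotential (e : ℝ) (χ : Space → ℝ) (r x : Space) : ℝ := (1 - χ x) * singPotential e r x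

lemma contDiff_farPotential (e : ℝ) {χ : Space → ℝ} (hχ : ContDiff ℝ 1 χ) {r : Space}
    (h1 : ∀ᶠ y in 𝓝 r, χ y = 1) : ContDiff ℝ 1 (farPotential e χ r) := by
  rw [contDiff_iff_contDiffAt]
  intro x
  rcases eq_or_ne x r with rfl | hx
  · refine (contDiffAt_const (c := (0 : ℝ))).congr_of_eventuallyEq ?_
    filter_upwards [h1] with y hy
    simp [farPotential, hy]
  · exact (contDiffAt_const.sub hχ.contDiffAt).mul (contDiffAt_singPotential e hx)

lemma fderiv_farPotential (e : ℝ) {χ : Space → ℝ} (hχ : ContDiff ℝ 1 χ) {r : Space}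
    (h1 : ∀ᶠ y in 𝓝 r, χ y = 1) (x y : Space) :
    fderiv ℝ (farPotential e χ r) x y =
      -((1 - χ x) * inner ℝ (singField e r x) y) - singPotential e r x * fderiv ℝ χ x y := by
  rcases eq_or_ne x r with rfl | hx
  · have : farPotential e χ x =ᶠ[𝓝 x] fun _ => 0 := by
      filter_upwards [h1] with y hy
      simp [farPotential, hy]
    rw [this.fderiv_eq, h1.self_of_nhds]
    -- At the charge the two sides agree because division by zero gives `singPotential e x x = 0`
    -- and `1 - χ x = 0`.
    simp [singPotential]
  · have hd := hχ.differentiable one_ne_zero x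
    have hG := (contDiffAt_singPotential e hx (n := 1)).differentiableAt one_ne_zero
    unfold farPotential
    rw [fderiv_fun_mul (hd.const_sub 1) hG, fderiv_const_sub]
    simp only [_root_.add_apply, _root_.smul_apply, smul_eq_mul, _root_.neg_apply,
      fderiv_singPotential e hx]
    ring

lemma tendsto_singPotential_cocompact (e : ℝ) (r : Space) :
    Tendsto (singPotential e r) (cocompact Space) (𝓝 0) := by
  have h1 : Tendsto (fun x : Space => ‖x - r‖) (cocompact Space) atTop := by
    have := tendsto_norm_cocompact_atTop (E := Space)
    exact this.comp (Homeomorph.subRight r).isClosedEmbedding.tendsto_cocompact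
  have h2 := (tendsto_inv_atTop_zero.comp h1).const_mul (|e| / (4 * Real.pi))
  rw [mul_zero] at h2
  exact squeeze_zero_norm (fun x => (abs_singPotential e r x).le) h2

lemma tendsto_farPotential_cocompact (e : ℝ) {χ : Space → ℝ} (hc : HasCompactSupport χ)
    (r : Space) : Tendsto (farPotential e χ r) (cocompact Space) (𝓝 0) := by
  refine (tendsto_singPotential_cocompact e r).congr' ?_
  filter_upwards [hc.isCompact.compl_mem_cocompact] with x hx
  simp [farPotential, image_eq_zero_of_notMem_tsupport hx]

/-- The energy pairing of a Coulomb field with a Coulomb potential cut off near both charges. -/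
lemma integral_fderiv_farPotential {V : Set Space} (hV : IsOpen V) (e : ℝ) {χ : Space → ℝ}
    (hχ : ContDiff ℝ 1 χ) (hc : HasCompactSupport χ) (hχV : tsupport χ ⊆ V) {r s : Space}
    (hr : ∀ᶠ y in 𝓝 r, χ y = 1) (hs : ∀ᶠ y in 𝓝 s, χ y = 1) :
    IntegrableOn (fun x => fderiv ℝ (farPotential e χ r) x (singField e s x)) V ∧
    IntegrableOn (fun x => inner ℝ (singField e r x) (singField e s x)) Vᶜ ∧
    ∫ x in V, fderiv ℝ (farPotential e χ r) x (singField e s x) =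
      ∫ x in Vᶜ, inner ℝ (singField e r x) (singField e s x) := by
  have hg := contDiff_farPotential e hχ hr
  have hfar : ∀ x ∉ tsupport χ, fderiv ℝ (farPotential e χ r) x (singField e s x) =
      -inner ℝ (singField e r x) (singField e s x) := by
    intro x hx
    rw [fderiv_farPotential e hχ hr, image_eq_zero_of_notMem_tsupport hx,
      fderiv_of_notMem_tsupport (𝕜 := ℝ) hx]
    simp
  have hmem : ∀ {q : Space}, (∀ᶠ y in 𝓝 q, χ y = 1) → q ∈ interior (tsupport χ) := by
    intro q hq
    rw [mem_interior_iff_mem_nhds]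
    filter_upwards [hq] with y hy
    exact subset_tsupport _ (by simp [hy])
  have hm := measurable_fderiv_apply (hg.continuous_fderiv one_ne_zero) (measurable_singField e s)
  have hiK : IntegrableOn (fun x => fderiv ℝ (farPotential e χ r) x (singField e s x))
      (tsupport χ) := by
    obtain ⟨C, hC⟩ := hc.isCompact.exists_bound_of_continuousOn
      (hg.continuous_fderiv one_ne_zero).continuousOn
    refine (((locallyIntegrable_singField e s).integrableOn_isCompact hc).norm.const_mul C).mono'
      hm.aestronglyMeasurable ?_
    filter_upwards [ae_restrict_mem (isClosed_tsupport χ).measurableSet] with x hx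
    exact ((fderiv ℝ _ x).le_opNorm _).trans
      (mul_le_mul_of_nonneg_right (hC x hx) (norm_nonneg _))
  have hiKc : IntegrableOn (fun x => fderiv ℝ (farPotential e χ r) x (singField e s x))
      (tsupport χ)ᶜ := by
    have hsq : ∀ {q : Space}, (∀ᶠ y in 𝓝 q, χ y = 1) →
        IntegrableOn (fun x => ‖singField e q x‖ ^ 2) (tsupport χ)ᶜ := fun hq =>
      integrableOn_sq_norm_singField e (by
        rw [compl_compl]; exact mem_interior_iff_mem_nhds.1 (hmem hq))
    refine ((hsq hr).add (hsq hs)).mono' hm.aestronglyMeasurable ?_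
    filter_upwards [ae_restrict_mem (isClosed_tsupport χ).isOpen_compl.measurableSet] with x hx
    rw [hfar x hx, norm_neg, Pi.add_apply]
    refine (norm_inner_le_norm _ _).trans ?_
    nlinarith [sq_nonneg (‖singField e r x‖ - ‖singField e s x‖),
      sq_nonneg ‖singField e r x‖, sq_nonneg ‖singField e s x‖]
  have hi : Integrable (fun x => fderiv ℝ (farPotential e χ r) x (singField e s x)) := by
    rw [← integrableOn_univ, ← union_compl_self (tsupport χ)]
    exact hiK.union hiKc
  have hV' : ∀ x ∈ Vᶜ, fderiv ℝ (farPotential e χ r) x (singField e s x) =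
      -inner ℝ (singField e r x) (singField e s x) := fun x hx => hfar x fun h => hx (hχV h)
  have hiVc : IntegrableOn (fun x => inner ℝ (singField e r x) (singField e s x)) Vᶜ := by
    refine (hi.neg.integrableOn (s := Vᶜ)).congr_fun (fun x hx => ?_) hV.measurableSet.compl
    rw [Pi.neg_apply, hV' x hx, neg_neg]
  refine ⟨hi.integrableOn, hiVc, ?_⟩
  -- Over all of space the pairing equals `-e` times the cut-off potential at `s`, which is zero.
  -- Outside `V` the cutoff is invisible, so the interior integral is the exterior Coulomb pairing.
  have htot := integral_fderiv_singField hg (tendsto_farPotential_cocompact e hc r) hi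
  have h0 : farPotential e χ r s = 0 := by simp [farPotential, hs.self_of_nhds]
  rw [h0, mul_zero, neg_zero, ← integral_add_compl hV.measurableSet hi,
    setIntegral_congr_fun hV.measurableSet.compl hV', integral_neg] at htot
  linarith

/-- A harmonic field does not see the cutoff of a Coulomb potential. -/
lemma IsHarmonicField.integral_fderiv_farPotential {V : Set Space} (hV : IsOpen V)
    (hVb : Bornology.IsBounded V) {v : Space → ℝ} {E : Space → Space} (h : IsHarmonicField V v E)
    (e : ℝ) {χ : Space → ℝ} (hχ : ContDiff ℝ 1 χ) (hc : HasCompactSupport χ)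
    (hχV : tsupport χ ⊆ V) {r : Space} (hr : ∀ᶠ y in 𝓝 r, χ y = 1) :
    ∫ x in V, fderiv ℝ (farPotential e χ r) x (E x) =
      -∫ x in V, inner ℝ (singField e r x) (E x) := by
  have hE : ContinuousOn E V := h.continuousOn_field.mono subset_closure
  have i1 := integrableOn_singPotential_mul e r hE hχ hc hχV
  have i2 := integrableOn_mul_inner_singField e r hE hχ.continuous hc hχV
  have i3 := integrableOn_inner_singField e r hVb.isCompact_closure h.continuousOn_field
    hV.measurableSet subset_closure
  -- The removed piece `χ` times the Coulomb potential is weakly orthogonal to `E`.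
  have h1 := h.integral_localized_singPotential hV e r hχ hc hχV
  have h2 : ∀ x, fderiv ℝ (farPotential e χ r) x (E x) =
      χ x * inner ℝ (singField e r x) (E x) - inner ℝ (singField e r x) (E x) -
        singPotential e r x * fderiv ℝ χ x (E x) := fun x => by
    rw [fderiv_farPotential e hχ hr]
    ring
  simp only [h2]
  have i23 : IntegrableOn (fun x => χ x * inner ℝ (singField e r x) (E x) -
    inner ℝ (singField e r x) (E x)) V := i2.sub i3
  rw [integral_sub i23 i1, integral_sub i2 i3, h1]
  ring

lemma exists_cutoff {V F : Set Space} (hV : IsOpen V) (hF : IsCompact F) (hFV : F ⊆ V) :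
    ∃ χ : Space → ℝ, ContDiff ℝ 1 χ ∧ HasCompactSupport χ ∧ tsupport χ ⊆ V ∧
      ∀ r ∈ F, ∀ᶠ y in 𝓝 r, χ y = 1 := by
  obtain ⟨K, hK, hFK, hKV⟩ := exists_compact_between hF hV hFV
  obtain ⟨f, hf1, hf0, -⟩ := exists_contMDiffMap_one_nhds_of_subset_interior (n := 1)
    (modelWithCornersSelf ℝ Space) hF.isClosed hFK
  have hsub : tsupport f ⊆ K := closure_minimal (fun x hx => by
    by_contra h; exact hx (hf0 x h)) hK.isClosed
  exact ⟨f, f.contMDiff.contDiff, hK.of_isClosed_subset (isClosed_tsupport _) hsub,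
    hsub.trans hKV, fun r hr => eventually_nhdsSet_iff_forall.1 hf1 r hr⟩

/-! ### Mean value formula and an interior estimate for harmonic functions. -/

/-- The kernel of the mean value formula for harmonic functions belonging to the cutoff `χ`. -/
def meanValueKernel (χ : Space → ℝ) (z : Space) : ℝ :=
  divergence (fun y => singPotential 1 0 y • gradient χ y) z - fderiv ℝ χ z (singField 1 0 z)

lemma gradient_eq_zero_of_notMem_tsupport {χ : Space → ℝ} {z : Space} (hz : z ∉ tsupport χ) :
    gradient χ z = 0 := by
  rw [gradient, fderiv_of_notMem_tsupport (𝕜 := ℝ) hz, map_zero]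

lemma eventually_gradient_eq_zero {χ : Space → ℝ} {z : Space} {c : ℝ}
    (hz : ∀ᶠ y in 𝓝 z, χ y = c) : ∀ᶠ y in 𝓝 z, gradient χ y = 0 := by
  filter_upwards [hz.eventually_nhds] with y hy
  rw [Filter.EventuallyEq.gradient_eq (f := fun _ => c) hy, gradient_fun_const]

section Kernel

variable {χ : Space → ℝ}

/-- Since `χ` is constant near the origin, its gradient vanishes where the Coulomb potential is
singular. -/
lemma contDiff_kernelField (hχ : ContDiff ℝ 2 χ) (h1 : ∀ᶠ y in 𝓝 (0 : Space), χ y = 1) :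
    ContDiff ℝ 1 (fun y => singPotential 1 0 y • gradient χ y) := by
  rw [contDiff_iff_contDiffAt]
  intro x
  rcases eq_or_ne x 0 with rfl | hx
  · refine (contDiffAt_const (c := (0 : Space))).congr_of_eventuallyEq ?_
    filter_upwards [eventually_gradient_eq_zero h1] with y hy
    rw [hy, smul_zero]
  · exact (contDiffAt_singPotential 1 hx).smul
      ((InnerProductSpace.toDual ℝ Space).symm.contDiff.comp
        (hχ.fderiv_right (m := 1) (by norm_num))).contDiffAt

lemma tsupport_kernelField : tsupport (fun y => singPotential 1 0 y • gradient χ y) ⊆ tsupport χ :=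
  closure_minimal (fun y hy => by
    by_contra h
    exact hy (by simp only [gradient_eq_zero_of_notMem_tsupport h, smul_zero]))
    (isClosed_tsupport χ)

lemma continuous_divergence {q : Space → Space} (hq : ContDiff ℝ 1 q) :
    Continuous (divergence q) :=
  continuous_finsetSum _ fun i _ =>
    ((contDiff_euclidean.1 hq i).continuous_fderiv one_ne_zero).clm_apply continuous_const

lemma divergence_eq_zero_of_notMem_tsupport {q : Space → Space} {z : Space}
    (hz : z ∉ tsupport q) : divergence q z = 0 := by
  refine Finset.sum_eq_zero fun i _ => ?_
  have : (fun y => q y i) =ᶠ[𝓝 z] fun _ => 0 := by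
    filter_upwards [notMem_tsupport_iff_eventuallyEq.1 hz] with y hy
    rw [hy]
    rfl
  rw [this.fderiv_eq]
  simp

lemma continuous_meanValueKernel (hχ : ContDiff ℝ 2 χ) (h1 : ∀ᶠ y in 𝓝 (0 : Space), χ y = 1) :
    Continuous (meanValueKernel χ) := by
  refine (continuous_divergence (contDiff_kernelField hχ h1)).sub ?_
  rw [continuous_iff_continuousAt]
  intro x
  rcases eq_or_ne x 0 with rfl | hx
  · refine (continuousAt_const (y := (0 : ℝ))).congr ?_
    filter_upwards [eventually_gradient_eq_zero h1] with y hy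
    rw [← inner_gradient_left, hy, inner_zero_left]
  · exact ((hχ.continuous_fderiv two_ne_zero).continuousAt).clm_apply
      (continuousAt_singField 1 hx)

lemma meanValueKernel_eq_zero {z : Space} (hz : z ∉ tsupport χ) : meanValueKernel χ z = 0 := by
  rw [meanValueKernel, divergence_eq_zero_of_notMem_tsupport fun h => hz (tsupport_kernelField h),
    fderiv_of_notMem_tsupport (𝕜 := ℝ) hz]
  simp

/-- The mean value formula for a weakly harmonic function. -/
lemma IsHarmonicField.eq_integral_meanValueKernel (hχ : ContDiff ℝ 2 χ)
    (hc : HasCompactSupport χ) (h1 : ∀ᶠ y in 𝓝 (0 : Space), χ y = 1)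
    {V : Set Space} (hV : IsOpen V) (hVb : Bornology.IsBounded V) {v : Space → ℝ}
    {E : Space → Space} (h : IsHarmonicField V v E) {x : Space}
    (hx : ∀ z ∈ tsupport χ, z + x ∈ V) :
    v x = ∫ y in V, v y * meanValueKernel χ (y - x) := by
  set η : Space → ℝ := fun y => χ (y - x) with hη
  set q : Space → Space := fun y => singPotential 1 0 (y - x) • gradient χ (y - x) with hq
  have hηd : ContDiff ℝ 1 η := (hχ.of_le one_le_two).comp (contDiff_id.sub contDiff_const)
  have hηs : tsupport η ⊆ (fun y => y - x) ⁻¹' tsupport χ :=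
    tsupport_comp_subset_preimage χ (by fun_prop)
  have hηc : HasCompactSupport η := hc.comp_homeomorph (Homeomorph.subRight x)
  have hηV : tsupport η ⊆ V := fun y hy => by simpa using hx _ (hηs hy)
  have hη1 : η x = 1 := by simpa [hη] using h1.self_of_nhds
  have hqd : ContDiff ℝ 1 q :=
    (contDiff_kernelField hχ h1).comp (contDiff_id.sub contDiff_const)
  have hqs : tsupport q ⊆ (fun y => y - x) ⁻¹' tsupport χ :=
    (tsupport_comp_subset_preimage (fun y => singPotential 1 0 y • gradient χ y)
      (by fun_prop)).trans (preimage_mono tsupport_kernelField)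
  have hqc : HasCompactSupport q := by
    refine HasCompactSupport.comp_homeomorph
      (f := fun y => singPotential 1 0 y • gradient χ y) ?_ (Homeomorph.subRight x)
    exact hc.of_isClosed_subset (isClosed_tsupport _) tsupport_kernelField
  have hqV : tsupport q ⊆ V := fun y hy => by simpa using hx _ (hqs hy)
  have hEV : ContinuousOn E V := h.continuousOn_field.mono subset_closure
  have hηf : ∀ y, fderiv ℝ η y = fderiv ℝ χ (y - x) := fun y => fderiv_comp_sub x
  have hS : ∀ y, singField 1 0 (y - x) = singField 1 x y := fun y => by simp [singField]
  have hG : ∀ y, singPotential 1 0 (y - x) = singPotential 1 x y := fun y => by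
    simp [singPotential]
  have hk : ∀ y, meanValueKernel χ (y - x) = divergence q y - fderiv ℝ η y (singField 1 x y) := by
    intro y
    rw [meanValueKernel, hηf, hS]
    congr 1
    refine Finset.sum_congr rfl fun i _ => ?_
    rw [hq]
    exact congrArg (fun L : Space →L[ℝ] ℝ => L (stdVec i)) (fderiv_comp_sub (𝕜 := ℝ)
      (f := fun z => (singPotential 1 0 z • gradient χ z) i) x).symm
  have hψ := contDiff_mul_of_tsupport_subset hV hηd hηV h.contDiffOn
  have hψc : HasCompactSupport fun y => η y * v y := hηc.mul_right
  have hψV : tsupport (fun y => η y * v y) ⊆ V := tsupport_mul_subset_left.trans hηV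
  -- The fundamental solution tested with `η * v` produces the value `v x`. The other terms cancel
  -- because `E` is orthogonal to the gradient of the localized Coulomb potential.
  have e1 := setIntegral_fderiv_singField 1 x hψ hψc hψV
  have i1 := (integral_fderiv_singField_of_hasCompactSupport 1 x hψ hψc).1.integrableOn (s := V)
  have i2 := integrableOn_mul_inner_singField 1 x hEV hηd.continuous hηc hηV
  have hpt : ∀ y ∈ V, v y * fderiv ℝ η y (singField 1 x y) =
      fderiv ℝ (fun y => η y * v y) y (singField 1 x y) +
        η y * inner ℝ (singField 1 x y) (E y) := by
    intro y hy
    have hvd := (h.contDiffOn.differentiableOn one_ne_zero).differentiableAt (hV.mem_nhds hy)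
    rw [fderiv_fun_mul (hηd.differentiable one_ne_zero y) hvd]
    simp only [_root_.add_apply, _root_.smul_apply, smul_eq_mul, h.fderiv_eq y hy]
    rw [real_inner_comm]
    ring
  have i3 : IntegrableOn (fun y => v y * fderiv ℝ η y (singField 1 x y)) V :=
    (i1.add i2).congr_fun (fun y hy => (hpt y hy).symm) hV.measurableSet
  have i4 : IntegrableOn (fun y => v y * divergence q y) V :=
    integrableOn_of_continuousOn_closure hVb
      (h.continuousOn_potential.mul (continuous_divergence hqd).continuousOn)
  have e2 := setIntegral_mul_divergence hV hqd hqc hqV h.contDiffOn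
  have e3 := h.integral_localized_singPotential hV 1 x hηd hηc hηV
  have e4 : ∫ y in V, fderiv ℝ v y (q y) =
      -∫ y in V, singPotential 1 x y * fderiv ℝ η y (E y) := by
    rw [← integral_neg]
    refine setIntegral_congr_fun hV.measurableSet fun y hy => ?_
    simp only [hq]
    rw [h.fderiv_eq y hy, inner_smul_right, hG, hηf, inner_gradient_right, conj_trivial]
  simp only [hk, mul_sub]
  rw [integral_sub i4 i3, setIntegral_congr_fun hV.measurableSet hpt, integral_add i1 i2, e1, e2,
    e4, e3, hη1]
  ring

end Kernel

/-- Near a point of `V`, differences of a harmonic function are bounded by the integral of its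
gradient. -/
lemma exists_harmonic_sub_le {V : Set Space} (hV : IsOpen V) (hVb : Bornology.IsBounded V)
    {x₀ : Space} (hx₀ : x₀ ∈ V) :
    ∃ δ > 0, ∃ K ≥ 0, ball x₀ δ ⊆ V ∧ ∀ (v : Space → ℝ) (E : Space → Space),
      IsHarmonicField V v E → ∀ x ∈ ball x₀ δ,
        |v x - v x₀| ≤ K * (∫ y in V, ‖E y‖) * ‖x - x₀‖ := by
  obtain ⟨R, hR, hRV⟩ := Metric.mem_nhds_iff.1 (hV.mem_nhds hx₀)
  -- A point of `ball x₀ d` shifted by the kernel's support, of radius `d`, stays within `2 * d < R`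
  -- of `x₀`.
  set d := R / 3 with hd
  have hd0 : 0 < d := by positivity
  have hFV : closedBall x₀ (2 * d) ⊆ V := fun y hy => hRV (by
    rw [mem_closedBall] at hy
    rw [mem_ball]
    linarith)
  let f : ContDiffBump (0 : Space) := ⟨d / 2, d, by positivity, by linarith⟩
  have hfs : tsupport f = closedBall 0 d := f.tsupport_eq
  have hf1 : ∀ᶠ y in 𝓝 (0 : Space), f y = 1 := f.eventuallyEq_one
  have hf2 : ContDiff ℝ 2 f := f.contDiff
  set k := meanValueKernel f with hk
  have hkc : Continuous k := continuous_meanValueKernel hf2 hf1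
  have hk0 : ∀ z ∉ closedBall (0 : Space) d, k z = 0 := fun z hz =>
    meanValueKernel_eq_zero (by rwa [hfs])
  have hkcs : HasCompactSupport k :=
    HasCompactSupport.of_support_subset_isCompact (isCompact_closedBall 0 d) fun z hz => by
      by_contra h
      exact hz (hk0 z h)
  obtain ⟨K, hK⟩ := hkc.norm.bddAbove_range_of_hasCompactSupport hkcs.norm
  have hK0 : 0 ≤ K := (norm_nonneg _).trans (hK ⟨0, rfl⟩)
  obtain ⟨χ, hχ, hχc, hχV, hχ1⟩ := exists_cutoff hV (isCompact_closedBall x₀ (2 * d)) hFV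
  have hnear : ∀ x ∈ ball x₀ d, ∀ z ∈ closedBall (0 : Space) d, z + x ∈ closedBall x₀ (2 * d) := by
    intro x hx z hz
    rw [mem_closedBall, dist_eq_norm] at hz ⊢
    rw [mem_ball, dist_eq_norm] at hx
    rw [sub_zero] at hz
    have := norm_add_le z (x - x₀)
    rw [add_sub_assoc]
    linarith
  have hdV : ball x₀ d ⊆ V := fun y hy => hFV (ball_subset_closedBall.trans
    (closedBall_subset_closedBall (by linarith)) hy)
  refine ⟨d, hd0, K, hK0, hdV, fun v E h x hx => ?_⟩
  -- A global `C¹` replacement for `v`, equal to it wherever the kernel looks. Differentiating under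
  -- the integral then puts the derivative on `w`, so `fderiv ℝ v` is an average of the field
  -- against `k` and is bounded by `sup ‖k‖` times its L¹ norm. The constant `K` depends only on the
  -- kernel.
  set w : Space → ℝ := fun y => χ y * v y with hw
  have hwd : ContDiff ℝ 1 w := contDiff_mul_of_tsupport_subset hV hχ hχV h.contDiffOn
  have hwc : HasCompactSupport w := hχc.mul_right
  have hrep : ∀ y ∈ ball x₀ d, v y = ∫ z, k z * w (z + y) := by
    intro y hy
    rw [h.eq_integral_meanValueKernel hf2 f.hasCompactSupport hf1 hV hVb
      (fun z hz => hFV (hnear y hy z (hfs ▸ hz)))]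
    have a1 : ∫ z in V, v z * k (z - y) = ∫ z in V, k (z - y) * w z := by
      refine setIntegral_congr_fun hV.measurableSet fun z _ => ?_
      by_cases hz : z - y ∈ closedBall (0 : Space) d
      · have := hnear y hy _ hz
        rw [sub_add_cancel] at this
        simp only [hw, (hχ1 z this).self_of_nhds]
        ring
      · simp only [hk0 _ hz, mul_zero, zero_mul]
    rw [a1, setIntegral_eq_integral_of_forall_compl_eq_zero,
      ← integral_add_right_eq_self (fun z => k (z - y) * w z) y]
    · simp only [add_sub_cancel_right]
    · intro z hz
      simp only [hw, image_eq_zero_of_notMem_tsupport fun h' => hz (hχV h'), zero_mul, mul_zero]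
  obtain ⟨C, hC⟩ := (hwd.continuous_fderiv one_ne_zero).norm.bddAbove_range_of_hasCompactSupport
    (hwc.fderiv ℝ).norm
  have hder : ∀ y ∈ ball x₀ d, HasFDerivAt v (∫ z, k z • fderiv ℝ w (z + y)) y := by
    intro y hy
    have a1 : HasFDerivAt (fun y => ∫ z, k z * w (z + y)) (∫ z, k z • fderiv ℝ w (z + y)) y := by
      refine hasFDerivAt_integral_of_dominated_of_fderiv_le (F := fun y z => k z * w (z + y))
        (F' := fun y z => k z • fderiv ℝ w (z + y)) (bound := fun z => ‖k z‖ * C) univ_mem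
        (Eventually.of_forall fun u => ?_) ?_ ?_ (ae_of_all _ fun z u _ => ?_) ?_
        (ae_of_all _ fun z u _ => ?_)
      · exact (hkc.mul (hwd.continuous.comp (by fun_prop))).aestronglyMeasurable
      · exact (hkc.mul (hwd.continuous.comp (by fun_prop))).integrable_of_hasCompactSupport
          hkcs.mul_right
      · exact (hkc.smul ((hwd.continuous_fderiv one_ne_zero).comp
          (by fun_prop))).aestronglyMeasurable
      · rw [norm_smul]
        exact mul_le_mul_of_nonneg_left (hC ⟨_, rfl⟩) (norm_nonneg _)
      · exact (hkc.norm.integrable_of_hasCompactSupport hkcs.norm).mul_const C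
      · have b1 : HasFDerivAt (fun y => z + y) (ContinuousLinearMap.id ℝ Space) u :=
          (hasFDerivAt_id u).const_add z
        exact ((hwd.differentiable one_ne_zero _).hasFDerivAt.comp u b1).const_mul (k z)
    refine a1.congr_of_eventuallyEq ?_
    filter_upwards [isOpen_ball.mem_nhds hy] with u hu using hrep u hu
  have hbound : ∀ y ∈ ball x₀ d, ‖fderiv ℝ v y‖ ≤ K * ∫ y in V, ‖E y‖ := by
    intro y hy
    have hEi : IntegrableOn (fun y => ‖E y‖) V :=
      integrableOn_of_continuousOn_closure hVb h.continuousOn_field.norm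
    have a1 : ∫ z, k z • fderiv ℝ w (z + y) = ∫ z, k (z - y) • fderiv ℝ w z := by
      rw [← integral_add_right_eq_self (fun z => k (z - y) • fderiv ℝ w z) y]
      simp only [add_sub_cancel_right]
    rw [(hder y hy).fderiv, a1, ← integral_const_mul, ← integral_indicator hV.measurableSet]
    refine norm_integral_le_of_norm_le
      ((integrable_indicator_iff hV.measurableSet).2 (hEi.const_mul K)) (ae_of_all _ fun z => ?_)
    by_cases hz : z - y ∈ closedBall (0 : Space) d
    · have hzF := hnear y hy _ hz
      rw [sub_add_cancel] at hzF
      have hwv : w =ᶠ[𝓝 z] v := by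
        filter_upwards [hχ1 z hzF] with u hu
        simp only [hw, hu, one_mul]
      rw [indicator_of_mem (hFV hzF), norm_smul, hwv.fderiv_eq]
      refine mul_le_mul (hK ⟨_, rfl⟩) ?_ (norm_nonneg _) hK0
      refine ContinuousLinearMap.opNorm_le_bound _ (norm_nonneg _) fun u => ?_
      rw [h.fderiv_eq z (hFV hzF), norm_neg]
      exact norm_inner_le_norm _ _
    · rw [hk0 _ hz, zero_smul, norm_zero]
      exact indicator_nonneg (fun u _ => by positivity) z
  rw [← Real.norm_eq_abs]
  exact (convex_ball x₀ d).norm_image_sub_le_of_norm_fderiv_le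
    (fun y hy => (hder y hy).differentiableAt) hbound (mem_ball_self hd0) hx

/-! ### Exact comparison of the energies at two positions. -/

lemma singField_neg (e : ℝ) (r x : Space) : singField (-e) r x = -singField e r x := by
  simp [singField, neg_div]

lemma singField_charge_zero (r x : Space) : singField 0 r x = 0 := by
  simp [singField]

lemma integrableOn_inner_of_continuousOn {V : Set Space} (hVb : Bornology.IsBounded V)
    {D E : Space → Space} (hD : ContinuousOn D (closure V)) (hE : ContinuousOn E (closure V)) :
    IntegrableOn (fun x => inner ℝ (D x) (E x)) V :=
  integrableOn_of_continuousOn_closure hVb (hD.inner hE)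

lemma IsHarmonicField.energyConverges {V : Set Space} (hV : IsOpen V)
    (hVb : Bornology.IsBounded V) {u : Space → ℝ} {D : Space → Space}
    (h : IsHarmonicField V u D) (e : ℝ) {r : Space} (hr : r ∈ V) : EnergyConverges V e r D :=
  ⟨integrableOn_sq_norm_singField e (by rw [compl_compl]; exact hV.mem_nhds hr),
    integrableOn_of_continuousOn_closure hVb (h.continuousOn_field.norm.pow 2),
    integrableOn_inner_singField e r hVb.isCompact_closure h.continuousOn_field
      hV.measurableSet subset_closure⟩

/-- The energy of the difference of two fields with charges at `r` and `s`. -/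
def energyGap (V : Set Space) (e : ℝ) (r s : Space) (D E : Space → Space) : ℝ :=
  (∫ x in V, ‖D x - E x‖ ^ 2) + ∫ x in Vᶜ, ‖singField e r x - singField e s x‖ ^ 2

lemma energyGap_comm (V : Set Space) (e : ℝ) (r s : Space) (D E : Space → Space) :
    energyGap V e r s D E = energyGap V e s r E D := by
  simp only [energyGap, norm_sub_rev (D _), norm_sub_rev (singField e r _)]

section TwoPositions

variable {V : Set Space} {e : ℝ} {r s : Space} {u v : Space → ℝ} {D E : Space → Space}

/-- The difference of two energies in terms of the difference of the fields. -/
lemma energy_sub_energy (hV : IsOpen V) (hVb : Bornology.IsBounded V) (hr : r ∈ V) (hs : s ∈ V)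
    (hu : IsHarmonicField V u D) (hv : IsHarmonicField V v E) (m : ℝ) {q : ℝ}
    (hq : ∫ x in V, inner ℝ (singField e r x) (D x - E x) =
      (∫ x in Vᶜ, inner ℝ (singField e r x) (singField e r x)) -
        (∫ x in Vᶜ, inner ℝ (singField e r x) (singField e s x)) + q) :
    energy V m e r D - energy V m e s E =
      (∫ x in V, inner ℝ (E x) (D x - E x)) + (∫ x in V, inner ℝ (singField e r x) (E x)) -
        (∫ x in V, inner ℝ (singField e s x) (E x)) + energyGap V e r s D E / 2 + q := by
  obtain ⟨a1, a2, a3⟩ := hu.energyConverges hV hVb e hr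
  obtain ⟨b1, b2, b3⟩ := hv.energyConverges hV hVb e hs
  obtain ⟨χ, hχ, hχc, hχV, hχ1⟩ := exists_cutoff hV
    (Set.toFinite ({r, s} : Set Space)).isCompact (by rintro x (rfl | rfl) <;> assumption)
  have hrs := (integral_fderiv_farPotential hV e hχ hχc hχV (hχ1 r (by simp))
    (hχ1 s (by simp))).2.1
  have c1 := integrableOn_inner_singField e r hVb.isCompact_closure hv.continuousOn_field
    hV.measurableSet subset_closure
  have c2 : IntegrableOn (fun x => inner ℝ (E x) (D x - E x)) V :=
    integrableOn_inner_of_continuousOn hVb hv.continuousOn_field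
    (hu.continuousOn_field.sub hv.continuousOn_field)
  have g1 : ∫ x in Vᶜ, ‖singField e r x - singField e s x‖ ^ 2 =
      (∫ x in Vᶜ, ‖singField e r x‖ ^ 2) -
        2 * (∫ x in Vᶜ, inner ℝ (singField e r x) (singField e s x)) +
        ∫ x in Vᶜ, ‖singField e s x‖ ^ 2 := by
    have i1 : IntegrableOn (fun x => ‖singField e r x‖ ^ 2 -
      2 * inner ℝ (singField e r x) (singField e s x)) Vᶜ := a1.sub (hrs.const_mul 2)
    simp only [norm_sub_sq_real]
    rw [integral_add i1 b1, integral_sub a1 (hrs.const_mul 2), integral_const_mul]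
  have g2 : ∫ x in V, ‖D x - E x‖ ^ 2 = (∫ x in V, ‖D x‖ ^ 2) - (∫ x in V, ‖E x‖ ^ 2) -
      2 * ∫ x in V, inner ℝ (E x) (D x - E x) := by
    have i1 : IntegrableOn (fun x => ‖D x‖ ^ 2 - ‖E x‖ ^ 2) V := a2.sub b2
    rw [← integral_const_mul, ← integral_sub a2 b2, ← integral_sub i1 (c2.const_mul 2)]
    refine integral_congr_ae (ae_of_all _ fun x => ?_)
    simp only [norm_sub_sq_real, inner_sub_right, real_inner_self_eq_norm_sq]
    rw [real_inner_comm (E x) (D x)]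
    ring
  have g3 : ∫ x in V, inner ℝ (singField e r x) (D x - E x) =
      (∫ x in V, inner ℝ (singField e r x) (D x)) -
        ∫ x in V, inner ℝ (singField e r x) (E x) := by
    simp only [inner_sub_right]
    exact integral_sub a3 c1
  -- Here `q` is what the boundary condition contributes to the pairing of the singular field with
  -- `D - E`: zero for Neumann data, `e * (u r - v r)` for Dirichlet data. The latter is cancelled
  -- by the potential term of the free energy.
  simp only [real_inner_self_eq_norm_sq] at hq
  rw [g3] at hq
  simp only [energy, energyGap]
  rw [g1, g2]
  linarith

/-- The difference of the total fields has charges `e` at `r` and `-e` at `s` and no normal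
component, so it can be paired with any gradient. Pairing with `farPotential e χ r` gives `q = 0` in
`energy_sub_energy`; pairing with `v` turns the terms linear in `E` into `e * (v r - v s)`. -/
lemma energy_sub_energy_of_neumann (hV : IsOpen V) (hVb : Bornology.IsBounded V)
    (hVC : HasC1Boundary V) (hr : r ∈ V) (hs : s ∈ V)
    (hu : IsHarmonicField V u D) (hv : IsHarmonicField V v E) (m : ℝ) {f : Space → ℝ}
    (hur : NeumannCondition V e r D f) (hvs : NeumannCondition V e s E f) :
    energy V m e r D - energy V m e s E = e * (v r - v s) + energyGap V e r s D E / 2 := by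
  have hw := hu.sub hV hv
  obtain ⟨χ, hχ, hχc, hχV, hχ1⟩ := exists_cutoff hV
    (Set.toFinite ({r, s} : Set Space)).isCompact (by rintro x (rfl | rfl) <;> assumption)
  have hχr := hχ1 r (by simp)
  have hχs := hχ1 s (by simp)
  have htan : ∀ x n : Space, IsOutwardUnitNormal V x n →
      inner ℝ (D x - E x + singField e r x + singField (-e) s x) n = 0 := by
    intro x n hn
    have h1 := hur x n hn
    rw [← hvs x n hn, ← sub_eq_zero, ← inner_sub_left] at h1
    rw [← h1, singField_neg]
    congr 1
    abel
  have hpair : ∀ {g : Space → ℝ} {Dg : Space → Space}, HasC1Extension V g Dg →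
      (∫ x in V, inner ℝ (Dg x) (D x - E x)) + (∫ x in V, inner ℝ (Dg x) (singField e r x)) -
        (∫ x in V, inner ℝ (Dg x) (singField e s x)) = -(e * (g r - g s)) := by
    intro g Dg hg
    have h1 := integral_gradient_inner_field hV hVb hVC hw hr hs (e₁ := e) (e₂ := -e) hg
      fun x n hn => by rw [htan x n hn, mul_zero]
    have i1 := integrableOn_inner_of_continuousOn hVb hg.continuousOn_gradient hw.continuousOn_field
    have i2 := fun q => integrableOn_inner_singField e q hVb.isCompact_closure
      hg.continuousOn_gradient hV.measurableSet subset_closure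
    simp only [real_inner_comm (Dg _) (singField e _ _)] at i2
    have i12 : IntegrableOn (fun x => inner ℝ (Dg x) (D x - E x) +
      inner ℝ (Dg x) (singField e r x)) V := i1.add (i2 r)
    have hpt : ∀ x, inner ℝ (Dg x) (D x - E x + singField e r x + singField (-e) s x) =
        inner ℝ (Dg x) (D x - E x) + inner ℝ (Dg x) (singField e r x) -
          inner ℝ (Dg x) (singField e s x) := fun x => by
      rw [singField_neg, ← sub_eq_add_neg, inner_sub_right, inner_add_right]
    simp only [hpt] at h1
    rw [integral_sub i12 (i2 s), integral_add i1 (i2 r)] at h1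
    rw [h1]
    ring
  have hfar := contDiff_farPotential e hχ hχr
  have h1 := hpair (hfar.hasC1Extension V)
  simp only [inner_gradient_left] at h1
  rw [hw.integral_fderiv_farPotential hV hVb e hχ hχc hχV hχr,
    (integral_fderiv_farPotential hV e hχ hχc hχV hχr hχr).2.2,
    (integral_fderiv_farPotential hV e hχ hχc hχV hχr hχs).2.2] at h1
  simp only [farPotential, hχr.self_of_nhds, hχs.self_of_nhds, sub_self, zero_mul, mul_zero,
    neg_zero] at h1
  have h2 := hpair hv.hasC1Extension
  simp only [inner_neg_left, integral_neg, real_inner_comm (singField e _ _) (E _)] at h2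
  rw [energy_sub_energy hV hVb hr hs hu hv m (q := 0) (by linarith)]
  linarith

/-- The difference of the total potentials vanishes on the boundary, so its cut-off version is a
test function that pairs with any field without a boundary term. Pairing with `E` removes the terms
linear in `E`; pairing with the Coulomb field at `r` gives `q = e * (u r - v r)`. -/
lemma freeEnergy_sub_freeEnergy_of_dirichlet (hV : IsOpen V) (hVb : Bornology.IsBounded V)
    (hVC : HasC1Boundary V) (hr : r ∈ V) (hs : s ∈ V)
    (hu : IsHarmonicField V u D) (hv : IsHarmonicField V v E) (m : ℝ) {f : Space → ℝ}
    (hur : DirichletCondition V e r u f) (hvs : DirichletCondition V e s v f) :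
    freeEnergy V m e r u D - freeEnergy V m e s v E =
      -e * (v r - v s) + energyGap V e r s D E / 2 := by
  have hw := hu.sub hV hv
  obtain ⟨χ, hχ, hχc, hχV, hχ1⟩ := exists_cutoff hV
    (Set.toFinite ({r, s} : Set Space)).isCompact (by rintro x (rfl | rfl) <;> assumption)
  have hχr := hχ1 r (by simp)
  have hχs := hχ1 s (by simp)
  have hfr := contDiff_farPotential e hχ hχr
  have hfs := contDiff_farPotential e hχ hχs
  have hψ := contDiff_mul_of_tsupport_subset hV hχ hχV hw.contDiffOn
  have hψc : HasCompactSupport fun x => χ x * (u x - v x) := hχc.mul_right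
  have hψV : tsupport (fun x => χ x * (u x - v x)) ⊆ V := tsupport_mul_subset_left.trans hχV
  have hfront : ∀ x ∈ frontier V, χ x = 0 := fun x hx => by
    rw [hV.frontier_eq] at hx
    exact image_eq_zero_of_notMem_tsupport fun h => hx.2 (hχV h)
  -- On the frontier `χ` vanishes, so the cut-off potentials coincide there with the Coulomb
  -- potentials.
  have hbdry : ∀ x ∈ frontier V,
      u x - v x - (farPotential e χ s x - farPotential e χ r x) = 0 := by
    intro x hx
    have h1 := hur x hx
    have h2 := hvs x hx
    simp only [farPotential, hfront x hx]
    linarith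
  have hcl := hVb.isCompact_closure
  have hfarE := ((hfs.hasC1Extension V).sub hV (hfr.hasC1Extension V))
  -- orthogonality of the difference of the total fields to the regular field
  have h1 : (∫ x in V, inner ℝ (E x) (D x - E x)) + (∫ x in V, inner ℝ (singField e r x) (E x)) -
      (∫ x in V, inner ℝ (singField e s x) (E x)) = 0 := by
    have h2 := integral_gradient_inner_field hV hVb hVC hv hr hs (e₁ := 0) (e₂ := 0)
      (hw.hasC1Extension.sub hV hfarE) fun x n hn => by rw [hbdry x hn.1, zero_mul]
    have i1 := integrableOn_inner_of_continuousOn hVb hw.continuousOn_field hv.continuousOn_field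
    have i2 := integrableOn_inner_of_continuousOn hVb
      (hfr.hasC1Extension V).continuousOn_gradient hv.continuousOn_field
    have i3 := integrableOn_inner_of_continuousOn hVb
      (hfs.hasC1Extension V).continuousOn_gradient hv.continuousOn_field
    have i1' : IntegrableOn (fun x => -inner ℝ (D x - E x) (E x)) V := i1.neg
    simp only [inner_gradient_left] at i2 i3
    have hpt : ∀ x, inner ℝ (-(D x - E x) -
        (gradient (farPotential e χ s) x - gradient (farPotential e χ r) x))
          (E x + singField 0 r x + singField 0 s x) = -inner ℝ (D x - E x) (E x) -
        (fderiv ℝ (farPotential e χ s) x (E x) - fderiv ℝ (farPotential e χ r) x (E x)) :=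
      fun x => by
        rw [singField_charge_zero, singField_charge_zero, add_zero, add_zero, inner_sub_left,
          inner_sub_left (gradient _ _), inner_gradient_left, inner_gradient_left, inner_neg_left]
    have i32 : IntegrableOn (fun x => fderiv ℝ (farPotential e χ s) x (E x) -
      fderiv ℝ (farPotential e χ r) x (E x)) V := i3.sub i2
    simp only [hpt, zero_mul, add_zero, neg_zero] at h2
    rw [integral_sub i1' i32, integral_sub i3 i2, integral_neg,
      hv.integral_fderiv_farPotential hV hVb e hχ hχc hχV hχr,
      hv.integral_fderiv_farPotential hV hVb e hχ hχc hχV hχs] at h2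
    simp only [real_inner_comm (D _ - E _) (E _)]
    linarith
  -- the pairing of the singular field with the difference of the regular fields
  have h3 : ∫ x in V, inner ℝ (singField e r x) (D x - E x) =
      (∫ x in Vᶜ, inner ℝ (singField e r x) (singField e r x)) -
        (∫ x in Vᶜ, inner ℝ (singField e r x) (singField e s x)) + e * (u r - v r) := by
    -- Subtracting `χ * (u - v)` makes the test function vanish at `r`; the value of `u - v` at `r`
    -- is recovered from the fundamental solution tested with the subtracted piece.
    have h2 := integral_gradient_inner_field hV hVb hVC (isHarmonicField_zero V) hr hs (e₁ := e)
      (e₂ := 0) ((hw.hasC1Extension.sub hV (hψ.hasC1Extension V)).sub hV hfarE) fun x n hn => by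
        have := hbdry x hn.1
        rw [hfront x hn.1, zero_mul, sub_zero, this, zero_mul]
    have i1 := integrableOn_inner_singField e r hcl hw.continuousOn_field hV.measurableSet
      subset_closure
    have i1' : IntegrableOn (fun x => -inner ℝ (D x - E x) (singField e r x)) V := by
      simp only [real_inner_comm (singField e r _)]
      exact i1.neg
    have i2 := (integral_fderiv_singField_of_hasCompactSupport e r hψ hψc).1.integrableOn (s := V)
    have i3 := (integral_fderiv_farPotential hV e hχ hχc hχV hχs hχr).1
    have i4 := (integral_fderiv_farPotential hV e hχ hχc hχV hχr hχr).1
    have i12 : IntegrableOn (fun x => -inner ℝ (D x - E x) (singField e r x) -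
      fderiv ℝ (fun x => χ x * (u x - v x)) x (singField e r x)) V := i1'.sub i2
    have hpt : ∀ x, inner ℝ (-(D x - E x) - gradient (fun x => χ x * (u x - v x)) x -
        (gradient (farPotential e χ s) x - gradient (farPotential e χ r) x))
          (0 + singField e r x + singField 0 s x) = -inner ℝ (D x - E x) (singField e r x) -
        fderiv ℝ (fun x => χ x * (u x - v x)) x (singField e r x) -
        (fderiv ℝ (farPotential e χ s) x (singField e r x) -
          fderiv ℝ (farPotential e χ r) x (singField e r x)) :=
      fun x => by
        rw [singField_charge_zero, add_zero, zero_add, inner_sub_left, inner_sub_left,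
          inner_sub_left (gradient (farPotential e χ s) x), inner_gradient_left,
          inner_gradient_left, inner_gradient_left, inner_neg_left]
    have i34 : IntegrableOn (fun x => fderiv ℝ (farPotential e χ s) x (singField e r x) -
      fderiv ℝ (farPotential e χ r) x (singField e r x)) V := i3.sub i4
    simp only [hpt, zero_mul, add_zero] at h2
    rw [integral_sub i12 i34, integral_sub i1' i2, integral_sub i3 i4, integral_neg,
      setIntegral_fderiv_singField e r hψ hψc hψV,
      (integral_fderiv_farPotential hV e hχ hχc hχV hχs hχr).2.2,
      (integral_fderiv_farPotential hV e hχ hχc hχV hχr hχr).2.2] at h2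
    simp only [farPotential, hχr.self_of_nhds, sub_self, zero_mul, one_mul, mul_zero,
      neg_zero] at h2
    simp only [real_inner_comm (D _ - E _) (singField e r _)]
    simp only [real_inner_comm (singField e s _) (singField e r _)] at h2 ⊢
    linarith
  have h4 := energy_sub_energy hV hVb hr hs hu hv m h3
  simp only [freeEnergy]
  linarith

end TwoPositions

/-! ### Second-order smallness of the gap and differentiability. -/

/-- If the variation of `Φ` equals the variation of the regular potential at a fixed field, up to
half of the energy gap, then the energy gap is of second order and `Φ` is differentiable. -/
lemma hasGradientAt_of_energyGap {V U : Set Space} (hV : IsOpen V) (hVb : Bornology.IsBounded V)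
    (hU : IsOpen U) (hUV : U ⊆ V) {e σ : ℝ} {u : Space → Space → ℝ} {D : Space → Space → Space}
    (hu : ∀ r ∈ U, IsHarmonicField V (u r) (D r)) {Φ : Space → ℝ}
    (hΦ : ∀ r ∈ U, ∀ s ∈ U,
      Φ r - Φ s = σ * (u s r - u s s) + energyGap V e r s (D r) (D s) / 2)
    {r₀ : Space} (hr₀ : r₀ ∈ U) : HasGradientAt Φ (-(σ • D r₀ r₀)) r₀ := by
  obtain ⟨δ, hδ, K, hK, -, hb⟩ := exists_harmonic_sub_le hV hVb (hUV hr₀)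
  set M := volume.real V
  have hVfin : volume V ≠ ⊤ := hVb.measure_lt_top.ne
  have hgap0 : ∀ r s, 0 ≤ ∫ x in Vᶜ, ‖singField e r x - singField e s x‖ ^ 2 := fun r s =>
    integral_nonneg fun x => by positivity
  have hgap : ∀ r ∈ U ∩ ball r₀ δ,
      |energyGap V e r r₀ (D r) (D r₀)| ≤ M * (|σ| * K) ^ 2 * ‖r - r₀‖ ^ 2 := by
    rintro r ⟨hr, hrb⟩
    have hw := (hu r hr).sub hV (hu r₀ hr₀)
    have h1 := hΦ r hr r₀ hr₀
    have h2 := hΦ r₀ hr₀ r hr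
    rw [energyGap_comm] at h2
    have h3 := hb _ _ hw r hrb
    set Q := energyGap V e r r₀ (D r) (D r₀) with hQ
    set L := |σ| * K * ‖r - r₀‖ with hL
    have hL0 : 0 ≤ L := by positivity
    set I := ∫ y in V, ‖D r y - D r₀ y‖
    set X := ∫ y in V, ‖D r y - D r₀ y‖ ^ 2 with hX
    have hX0 : 0 ≤ X := integral_nonneg fun x => by positivity
    have hXQ : X ≤ Q := le_add_of_nonneg_right (hgap0 r r₀)
    -- Adding the identity and its mirror image eliminates `Φ`, because the gap is symmetric.
    have hQ' : Q = σ * (u r r - u r₀ r - (u r r₀ - u r₀ r₀)) := by linarith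
    have hQL : Q ≤ L * I := by
      rw [hQ']
      refine (le_abs_self _).trans ?_
      rw [abs_mul]
      calc |σ| * _ ≤ |σ| * (K * I * ‖r - r₀‖) := mul_le_mul_of_nonneg_left h3 (abs_nonneg σ)
        _ = L * I := by rw [hL]; ring
    have i1 : IntegrableOn (fun y => ‖D r y - D r₀ y‖) V :=
      integrableOn_of_continuousOn_closure hVb hw.continuousOn_field.norm
    have i2 : IntegrableOn (fun y => ‖D r y - D r₀ y‖ ^ 2) V :=
      integrableOn_of_continuousOn_closure hVb (hw.continuousOn_field.norm.pow 2)
    have i3 : IntegrableOn (fun _ : Space => L ^ 2) V := integrableOn_const hVfin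
    -- Integrating `(‖D r y - D r₀ y‖ - L) ^ 2 ≥ 0`. With `Q ≤ L * I` and `X ≤ Q` this gives `2 * Q
    -- ≤ Q + L ^ 2 * M`, so the gap absorbs itself.
    have hI : 2 * L * I ≤ X + L ^ 2 * M := by
      have h4 : ∫ y in V, 2 * L * ‖D r y - D r₀ y‖ ≤ ∫ y in V, (‖D r y - D r₀ y‖ ^ 2 + L ^ 2) :=
        integral_mono (i1.const_mul _) (i2.add i3) fun y => by
          simp only []
          nlinarith [sq_nonneg (‖D r y - D r₀ y‖ - L)]
      rw [integral_const_mul, integral_add i2 i3, setIntegral_const, smul_eq_mul] at h4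
      linarith
    rw [abs_of_nonneg (hX0.trans hXQ)]
    calc Q ≤ L ^ 2 * M := by linarith
      _ = _ := by rw [hL]; ring
  have hnhds : U ∩ ball r₀ δ ∈ 𝓝 r₀ := inter_mem (hU.mem_nhds hr₀) (ball_mem_nhds r₀ hδ)
  have hO : (fun r => energyGap V e r r₀ (D r) (D r₀)) =O[𝓝 r₀] fun r => ‖r - r₀‖ ^ 2 := by
    refine Asymptotics.IsBigO.of_bound (M * (|σ| * K) ^ 2) ?_
    filter_upwards [hnhds] with r hr
    rw [Real.norm_of_nonneg (by positivity : 0 ≤ ‖r - r₀‖ ^ 2)]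
    exact hgap r hr
  -- A quadratic bound forces derivative zero, so only the fixed potential `u r₀` contributes.
  have hd1 := Asymptotics.IsBigO.hasFDerivAt (𝕜 := ℝ) hO one_lt_two
  have hur := hu r₀ hr₀
  have hd2 := ((hur.contDiffOn.differentiableOn one_ne_zero).differentiableAt
    (hV.mem_nhds (hUV hr₀))).hasFDerivAt
  have hd3 := (((hd2.sub_const (u r₀ r₀)).const_mul σ).add (hd1.const_mul (1 / 2 : ℝ))).const_add
    (Φ r₀)
  rw [hasGradientAt_iff_hasFDerivAt]
  have heq : InnerProductSpace.toDual ℝ Space (-(σ • D r₀ r₀)) =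
      σ • fderiv ℝ (u r₀) r₀ + (1 / 2 : ℝ) • (0 : Space →L[ℝ] ℝ) := by
    ext y
    simp only [InnerProductSpace.toDual_apply_apply, smul_zero, add_zero, _root_.smul_apply,
      smul_eq_mul, hur.fderiv_eq r₀ (hUV hr₀), inner_neg_left, inner_smul_left, conj_trivial]
    ring
  rw [heq]
  refine hd3.congr_of_eventuallyEq ?_
  filter_upwards [hU.mem_nhds hr₀] with r hr
  have := hΦ r hr r₀ hr₀
  simp only [Pi.add_apply]
  linarith

lemma equilibrium_iff {Φ : Space → ℝ} {σ : ℝ} {d r₀ : Space} (hσ : σ ≠ 0)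
    (h : HasGradientAt Φ (σ • d) r₀) :
    (HasGradientAt Φ 0 r₀ ↔ d = 0) ∧ (IsLocalExtr Φ r₀ → d = 0) := by
  have h1 : HasGradientAt Φ 0 r₀ → d = 0 := fun h0 =>
    (smul_eq_zero.1 (h.unique h0)).resolve_left hσ
  refine ⟨⟨h1, fun hd => by simpa [hd] using h⟩, fun hext => h1 ?_⟩
  have h2 := hext.hasFDerivAt_eq_zero h.hasFDerivAt
  rw [hasGradientAt_iff_hasFDerivAt, map_zero, ← h2]
  exact h.hasFDerivAt

end Monopole

end
theorem mainTheorem4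
    (V : Set Monopole.Space) (hVo : IsOpen V) (hVb : Bornology.IsBounded V)
    (hVC : Monopole.HasC1Boundary V)
    (U : Set Monopole.Space) (hUo : IsOpen U) (hUV : U ⊆ V)
    (m e : ℝ) (f : Monopole.Space → ℝ)
    (φreg : Monopole.Space → Monopole.Space → ℝ)
    (Dreg : Monopole.Space → Monopole.Space → Monopole.Space)
    (hfield : ∀ r ∈ U, Monopole.IsMonopoleField V e r (φreg r) (Dreg r)) :
    (∀ r ∈ U, Monopole.EnergyConverges V e r (Dreg r)) ∧
    ((∀ r ∈ U, Monopole.NeumannCondition V e r (Dreg r) f) →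
      ∀ r₀ ∈ U,
        HasGradientAt (fun r => Monopole.energy V m e r (Dreg r)) (-(e • Dreg r₀ r₀)) r₀ ∧
        (e ≠ 0 →
          (HasGradientAt (fun r => Monopole.energy V m e r (Dreg r)) 0 r₀ ↔ Dreg r₀ r₀ = 0) ∧
          (IsLocalExtr (fun r => Monopole.energy V m e r (Dreg r)) r₀ → Dreg r₀ r₀ = 0))) ∧
    ((∀ r ∈ U, Monopole.DirichletCondition V e r (φreg r) f) →
      ∀ r₀ ∈ U,
        HasGradientAt (fun r => Monopole.freeEnergy V m e r (φreg r) (Dreg r))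
          (e • Dreg r₀ r₀) r₀ ∧
        (e ≠ 0 →
          (HasGradientAt (fun r => Monopole.freeEnergy V m e r (φreg r) (Dreg r)) 0 r₀ ↔
            Dreg r₀ r₀ = 0) ∧
          (IsLocalExtr (fun r => Monopole.freeEnergy V m e r (φreg r) (Dreg r)) r₀ →
            Dreg r₀ r₀ = 0))) := by
  have hharm := fun r hr => (hfield r hr).isHarmonicField hVo
  refine ⟨fun r hr => (hharm r hr).energyConverges hVo hVb e (hUV hr), fun hN r₀ hr₀ => ?_,
    fun hD r₀ hr₀ => ?_⟩
  · have h := Monopole.hasGradientAt_of_energyGap hVo hVb hUo hUV (e := e) (σ := e) hharm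
      (fun r hr s hs => Monopole.energy_sub_energy_of_neumann hVo hVb hVC (hUV hr) (hUV hs)
        (hharm r hr) (hharm s hs) m (hN r hr) (hN s hs)) hr₀
    exact ⟨h, fun he => Monopole.equilibrium_iff (neg_ne_zero.2 he) (by rwa [neg_smul])⟩
  · have h := Monopole.hasGradientAt_of_energyGap hVo hVb hUo hUV (e := e) (σ := -e) hharm
      (fun r hr s hs => Monopole.freeEnergy_sub_freeEnergy_of_dirichlet hVo hVb hVC (hUV hr)
        (hUV hs) (hharm r hr) (hharm s hs) m (hD r hr) (hD s hs)) hr₀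
    rw [neg_smul, neg_neg] at h
    exact ⟨h, fun he => Monopole.equilibrium_iff he h⟩
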